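/- **Setting.** For $n\ge 0$, $m\ge 1$ and inputs $s=(s_0,\dots,s_{n-1})$, $t=(t_0,\dots,t_{m-1})$ let $f(s,t)=s_0\wedge\dots\wedge s_{n-1}\wedge\bigl(t_0\wedge(t_1\vee(t_2\wedge(t_3\vee\cdots)))\bigr)$ be the extended And-Or path, and let $f^*$ be its dual. Fix a real parameter $\xi$ with $1.9\le\xi<2$. For $d\ge1$ put $$\mu(d,n)=\xi\,\frac{2^d-n-2}{d}+2,\qquad d_{\min}(n,m)=\min\{d\ge 1: m\le\mu(d,n)\}.$$ For real $x$ let $\mathrm{flodd}(x)$ be the largest odd integer $\le x$. Let $\rho(n)=n$ for $n\le2$ and $\rho(n)=\lfloor 2\log_2(n-1)\rfloor$ for $n\ge3$. Let $$\psi(d)=\frac{1+\rho\bigl(\tfrac12(\mathrm{flodd}(\xi\frac{2^{d-1}-2}{d-1})+1)\bigr)}{\lceil \xi\frac{2^{d-1}-2}{d-1}\rceil+2}\quad(d\ge5),\qquad \phi(d)=\begin{cases}-1.67& d\le4,\\ \phi(d-1)+\psi(d)& d\ge5.\end{cases}$$ **Leftist circuits and symmetric trees.** The leftist $\circ$-circuit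 on an ordered list of inputs arises by repeatedly building a full ordered binary $\circ$-tree on the next $2^k$ inputs, with $k$ maximal such that $2^k$ inputs remain. The boundary trees of a set $K$ of inputs are the maximal subtrees of the leftist circuit all of whose inputs lie in $K$, ordered from left to right. A symmetric $\circ$-tree on $K$, and on further vertices $L$ with given arrival times, is built by Huffman coding (repeatedly joining by a new $\circ$-gate two vertices of smallest arrival time, the gate getting the larger of the two times plus $1$) on the roots of the boundary trees of $K$, whose arrival times are the depths of these trees, together with $L$. **Algorithm.** Build the leftist And-circuit $S_0$ on $s_0,\dots,s_{n-1},t_0,t_2,\dots$ and the leftist Or-circuit $S_1$ on $t_1,t_3,\dots$. Then build a circuit for $f(s,t)$ by the following recursion, where $n$ and $m$ denote the current lengths of $s$ and $t$; for $f^*$ exchange And with Or and $S_0$ with $S_1$. Let $\mathrm{sym}(s,\dots)$ denote the symmetric And-tree on the listed inputs and vertices. * If $m\le2$, or if $d:=d_{\min}(n,m)\le3$ (which implies $m\le5$), use for $m=1,\dots,5$ the base-case solution $\mathrm{sym}(s,t_0)$, $\mathrm{sym}(s,t_0,t_1)$, $\mathrm{sym}(s,t_0,t_1\vee t_2)$,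 $\mathrm{sym}(s,t_0,t_1\vee(t_2\wedge t_3))$, $\mathrm{sym}(s,t_0,t_1\vee t_2,t_1\vee t_3\vee t_4)$, respectively. Here $K$ consists of $s$ and $t_0$, the remaining arguments form $L$ with arrival times their depths, and $t_1\vee t_3\vee t_4$ is a symmetric Or-tree with $K=\{t_1,t_3\}$, $L=\{t_4\}$. * Otherwise, if $n\ge2^{d-1}$ (symmetric split), choose $s'\subseteq s$ as follows: if the boundary tree sequence of $s$ contains a tree of depth $\lfloor\log_2 n\rfloor$, let $s'$ be the inputs of such a tree; else let $D$ be the largest depth occurring twice, and let $s'$ be the inputs of the two trees of depth $D$ and of all trees between them. Return $\mathrm{sym}(s')\wedge f(s\setminus s',t)$. * Otherwise, if $m\le\mu(d-1,0)$ (simple split), return $\mathrm{sym}(s)\wedge f((),t)$. * Otherwise (alternating split) let $k=\mathrm{flodd}(\mu(d-1,n))$ and return $f\bigl(s,(t_0,\dots,t_{k-1})\bigr)\wedge f^*\bigl((t_1,t_3,\dots,t_{k-2}),(t_k,\dots,t_{m-1})\bigr)$. The *additional gates* are all gates built by this algorithm other than the gates of $S_0$ and $S_1$, i.e. the concatenation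 gates of alternating splits, the base-case gates, the gates of the symmetric trees in symmetric and simple splits, and the concatenation gates of these splits. **Lemma.** For all $n\ge0$ and $m\ge1$, the number of additional gates in the circuit computed by this algorithm for $n$ symmetric inputs $s$ and $m$ alternating inputs $t$ is at most $$\bigl(2.67+\phi(d)\bigr)\,m+\rho(n),\qquad d=d_{\min}(n,m).$$ -/

import Mathlib

/-! Circuits over the basis {And, Or}, leftist circuits, and the construction of circuits for
extended And-Or paths from leftist circuits. -/

namespace AndOrPath

/-! ### Circuits -/

inductive Op
  | and
  | or

def Op.dual : Op → Op
  | .and => .or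
  | .or => .and

/-- The five groups into which the gates of the constructed circuit are partitioned. -/
inductive GateKind
  | leftist
  | altSplit
  | baseCase
  | symTree
  | split

/-- The gates that are not gates of the two leftist circuits. -/
def GateKind.isAdditional : GateKind → Bool
  | .leftist => false
  | .altSplit => true
  | .baseCase => true
  | .symTree => true
  | .split => true

/-- A gate with fan-in two; `left` and `right` are its predecessor vertices. -/
structure Gate where
  op : Op
  left : ℕ
  right : ℕ
  kind : GateKind

/-- A circuit given by its gates in topological order. The vertices `0, …, numInputs - 1` are the
inputs, and the vertex `numInputs + i` is the `i`-th gate. -/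
structure Circuit where
  numInputs : ℕ
  gates : List Gate

def Circuit.numAdditionalGates (C : Circuit) : ℕ :=
  C.gates.countP fun g => g.kind.isAdditional

/-- Procedures that extend the current circuit by new gates and return a value. -/
abbrev Build := StateM Circuit

/-- Append a gate with predecessors `u` and `v`, and return the new vertex. -/
def addGate (kind : GateKind) (op : Op) (u v : ℕ) : Build ℕ := fun C =>
  (C.numInputs + C.gates.length, { C with gates := C.gates ++ [⟨op, u, v, kind⟩] })

/-! ### Leftist circuits and their boundary vertices -/

/-- An ordered binary tree inside a circuit; every node stores its vertex of the circuit. -/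
inductive Tree
  | leaf (v : ℕ)
  | node (v : ℕ) (l r : Tree)

/-- The output vertex of the tree. -/
def Tree.root : Tree → ℕ
  | .leaf v => v
  | .node v _ _ => v

/-- The inputs of the tree, from left to right. -/
def Tree.inputs : Tree → List ℕ
  | .leaf v => [v]
  | .node _ l r => l.inputs ++ r.inputs

def Tree.depth : Tree → ℕ
  | .leaf _ => 0
  | .node _ l r => max l.depth r.depth + 1

/-- The ordered full tree of depth `k` on a list `xs` of `2 ^ k` inputs. -/
def fullTree (op : Op) : ℕ → List ℕ → Build Tree
  | 0, xs => pure (.leaf (xs.headD 0))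
  | k + 1, xs => do
    let l ← fullTree op k (xs.take (2 ^ k))
    let r ← fullTree op k (xs.drop (2 ^ k))
    let v ← addGate .leftist op l.root r.root
    pure (.node v l r)

/-- The leftist circuit on the inputs `xs`, as a list of full trees from left to right: repeatedly
take the largest `k` such that at least `2 ^ k` inputs are left, and build a full tree on the next
`2 ^ k` inputs. (A last remaining single input gives a tree without gates.) -/
def leftist (op : Op) (xs : List ℕ) : Build (List Tree) :=
  if h : xs = [] then pure []
  else do
    let k := Nat.log 2 xs.length
    let T ← fullTree op k (xs.take (2 ^ k))
    let Ts ← leftist op (xs.drop (2 ^ k))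
    pure (T :: Ts)
termination_by xs.length
decreasing_by
  have h1 : 0 < xs.length := List.length_pos_of_ne_nil h
  have h2 : 0 < 2 ^ Nat.log 2 xs.length := by positivity
  rw [List.length_drop]
  omega

/-- The maximal subtrees of a tree all of whose inputs lie in `K`, from left to right. -/
def Tree.boundary (K : List ℕ) : Tree → List Tree
  | .leaf v => if v ∈ K then [.leaf v] else []
  | .node v l r =>
    if ∀ x ∈ l.inputs ++ r.inputs, x ∈ K then [.node v l r]
    else l.boundary K ++ r.boundary K

/-- The boundary tree sequence of a set `K` of inputs with respect to a leftist circuit. The roots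
of these trees are the boundary vertices: the vertices `v` such that all inputs in the cone of `v`
lie in `K`, while this fails for the successor of `v` (if there is one). -/
def boundaryTrees (K : List ℕ) (S : List Tree) : List Tree :=
  S.flatMap (Tree.boundary K)

/-- Choice of a subset `K` of a (triangular) set `N` of inputs of a leftist circuit `S`, where
`2 ^ (d - 1) ≤ |N| < 2 ^ d`, so `d - 1 = Nat.log 2 |N|`. If some boundary tree has depth `d - 1`,
then `K` consists of its inputs. Otherwise let `D` be the largest depth that occurs twice in the
boundary tree sequence; `K` consists of the inputs of the two trees of depth `D` and of all trees
between them. -/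
def triangularSubset (S : List Tree) (N : List ℕ) : List ℕ :=
  let Ts := boundaryTrees N S
  match Ts.find? (fun T => decide (T.depth = Nat.log 2 N.length)) with
  | some T => T.inputs
  | none =>
    let depths := Ts.map Tree.depth
    let D := (depths.filter fun e => decide (2 ≤ depths.count e)).foldr max 0
    let notD : Tree → Bool := fun T => decide (T.depth ≠ D)
    ((Ts.dropWhile notD).rdropWhile notD).flatMap Tree.inputs

/-! ### Symmetric trees -/

/-- Insert a pair (vertex, arrival time) into a list that is sorted by arrival time. -/
def insertByTime (x : ℕ × ℕ) : List (ℕ × ℕ) → List (ℕ × ℕ)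
  | [] => [x]
  | y :: ys => if x.2 ≤ y.2 then x :: y :: ys else y :: insertByTime x ys

theorem length_insertByTime (x : ℕ × ℕ) (l : List (ℕ × ℕ)) :
    (insertByTime x l).length = l.length + 1 := by
  induction l with
  | nil => rfl
  | cons y ys ih =>
    rw [insertByTime]
    split_ifs
    · rfl
    · simp [ih]

/-- Huffman coding on pairs (vertex, arrival time) sorted by arrival time: repeatedly combine two
vertices of smallest arrival time by a gate. -/
def huffmanSorted (kind : GateKind) (op : Op) : List (ℕ × ℕ) → Build ℕ
  | [] => pure 0
  | [x] => pure x.1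
  | x :: y :: rest => do
    let v ← addGate kind op x.1 y.1
    huffmanSorted kind op (insertByTime (v, max x.2 y.2 + 1) rest)
termination_by l => l.length
decreasing_by
  simp [length_insertByTime]

def huffman (kind : GateKind) (op : Op) (l : List (ℕ × ℕ)) : Build ℕ :=
  huffmanSorted kind op (l.foldr insertByTime [])

/-- A delay-optimum symmetric `op`-tree on the inputs `K` (arrival time 0) of the leftist
`op`-circuit `S op`, and on further vertices `L` with given arrival times: Huffman coding on the
boundary vertices of `K`, which are available at the time given by their depth, and on `L`. -/
def symTree (kind : GateKind) (S : Op → List Tree) (op : Op) (K : List ℕ) (L : List (ℕ × ℕ)) :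
    Build ℕ :=
  huffman kind op ((boundaryTrees K (S op)).map (fun T => (T.root, T.depth)) ++ L)

/-! ### The numerical parameters -/

/-- `μ(d, n) = ξ (2 ^ d - n - 2) / d + 2` for `d ≥ 1`. -/
noncomputable def mu (ξ : ℝ) (d n : ℕ) : ℝ := ξ * ((2 : ℝ) ^ d - n - 2) / d + 2

/-- The smallest `d ≥ 1` with `m ≤ μ(d, n)`. -/
noncomputable def dMin (ξ : ℝ) (n m : ℕ) : ℕ := sInf {d : ℕ | 1 ≤ d ∧ (m : ℝ) ≤ mu ξ d n}

/-- The largest odd integer that is at most `x`. -/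
noncomputable def flodd (x : ℝ) : ℤ := if Odd ⌊x⌋ then ⌊x⌋ else ⌊x⌋ - 1

theorem isGreatest_flodd (x : ℝ) : IsGreatest {y : ℤ | Odd y ∧ (y : ℝ) ≤ x} (flodd x) := by
  unfold flodd
  split_ifs with h
  · exact ⟨⟨h, Int.floor_le x⟩, fun y hy => Int.le_floor.2 hy.2⟩
  · rw [Int.not_odd_iff_even] at h
    refine ⟨⟨h.sub_odd odd_one, ?_⟩, fun y hy => ?_⟩
    · have := Int.floor_le x
      push_cast
      linarith
    · have h1 : y ≤ ⌊x⌋ := Int.le_floor.2 hy.2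
      have h2 : y ≠ ⌊x⌋ := fun e => (Int.not_even_iff_odd.2 hy.1) (e ▸ h)
      omega

/-- `ρ(n) = n` for `n ≤ 2` and `ρ(n) = ⌊2 log₂ (n - 1)⌋` for `n ≥ 3`. -/
noncomputable def rho (n : ℕ) : ℝ :=
  if n ≤ 2 then (n : ℝ) else ((⌊2 * Real.logb 2 ((n : ℝ) - 1)⌋ : ℤ) : ℝ)

/-- The function `ψ(d)`, used for `d ≥ 5`. The argument of `rho` is a positive integer. -/
noncomputable def psi (ξ : ℝ) (d : ℕ) : ℝ :=
  (1 + rho ((flodd (ξ * ((2 : ℝ) ^ (d - 1) - 2) / ((d : ℝ) - 1)) + 1) / 2).toNat) /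
    ((⌈ξ * ((2 : ℝ) ^ (d - 1) - 2) / ((d : ℝ) - 1)⌉ : ℝ) + 2)

/-- `φ(d) = -1.67` for `d ≤ 4` and `φ(d) = φ(d - 1) + ψ(d)` for `d ≥ 5`. -/
noncomputable def phi (ξ : ℝ) : ℕ → ℝ
  | 0 => -1.67
  | d + 1 => if d + 1 ≤ 4 then -1.67 else phi ξ d + psi ξ (d + 1)

/-! ### The algorithm -/

/-- The entries of a list at the positions `1, 3, 5, …`. -/
def oddEntries : List ℕ → List ℕ
  | _ :: y :: l => y :: oddEntries l
  | _ => []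

/-- The entries of a list at the positions `0, 2, 4, …`. -/
def evenEntries : List ℕ → List ℕ
  | x :: _ :: l => x :: evenEntries l
  | [x] => [x]
  | [] => []

/-- Realizations for at most two alternating inputs, and for three, four or five alternating inputs
in case that `dMin` is at most `3`. With `∧` for `op` and `∨` for its dual, they are
`sym(s, t₀)`, `sym(s, t₀, t₁)`, `sym(s, t₀, t₁ ∨ t₂)`, `sym(s, t₀, t₁ ∨ (t₂ ∧ t₃))` and
`sym(s, t₀, t₁ ∨ t₂, t₁ ∨ t₃ ∨ t₄)`, where `sym` denotes a symmetric tree. -/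
def baseCircuit (S : Op → List Tree) (op : Op) (s : List ℕ) : List ℕ → Build ℕ
  | [t₀] => symTree .baseCase S op (s ++ [t₀]) []
  | [t₀, t₁] => symTree .baseCase S op (s ++ [t₀]) [(t₁, 0)]
  | [t₀, t₁, t₂] => do
    let u ← addGate .baseCase op.dual t₁ t₂
    symTree .baseCase S op (s ++ [t₀]) [(u, 1)]
  | [t₀, t₁, t₂, t₃] => do
    let u ← addGate .baseCase op t₂ t₃
    let v ← addGate .baseCase op.dual t₁ u
    symTree .baseCase S op (s ++ [t₀]) [(v, 2)]
  | [t₀, t₁, t₂, t₃, t₄] => do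
    let u ← addGate .baseCase op.dual t₁ t₂
    let v ← symTree .baseCase S op.dual [t₁, t₃] [(t₄, 0)]
    symTree .baseCase S op (s ++ [t₀]) [(u, 1), (v, 2)]
  | _ => pure 0

/-- The recursive construction. For `op = and` it builds a circuit for the extended And-Or path
`f(s, t) = s₀ ∧ … ∧ sₙ₋₁ ∧ (t₀ ∧ (t₁ ∨ (t₂ ∧ (t₃ ∨ …))))`, for `op = or` one for its dual.
Each recursive call has fewer inputs in total, so that a value of `fuel` that is at least the number
of inputs never runs out. -/
noncomputable def aop (ξ : ℝ) (S : Op → List Tree) : ℕ → Op → List ℕ → List ℕ → Build ℕ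
  | 0, _, _, _ => pure 0
  | fuel + 1, op, s, t =>
    let n := s.length
    let m := t.length
    let d := dMin ξ n m
    if m ≤ 2 ∨ d ≤ 3 then baseCircuit S op s t
    else if 2 ^ (d - 1) ≤ n then do
      -- symmetric split
      let s' := triangularSubset (S op) s
      let a ← symTree .symTree S op s' []
      let b ← aop ξ S fuel op (s.filter fun x => x ∉ s') t
      addGate .split op a b
    else if (m : ℝ) ≤ mu ξ (d - 1) 0 then do
      -- simple split
      let a ← symTree .symTree S op s []
      let b ← aop ξ S fuel op [] t
      addGate .split op a b
    else do
      -- alternating split with an odd prefix of `t`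
      let k := (flodd (mu ξ (d - 1) n)).toNat
      let a ← aop ξ S fuel op s (t.take k)
      let b ← aop ξ S fuel op.dual (oddEntries (t.take k)) (t.drop k)
      addGate .altSplit op a b

/-- Build the leftist And-circuit on `s₀, …, sₙ₋₁, t₀, t₂, …` and the leftist Or-circuit on
`t₁, t₃, …`, apply the recursive construction, and return the output vertex. -/
noncomputable def linearAop (ξ : ℝ) (s t : List ℕ) : Build ℕ := do
  let S₀ ← leftist .and (s ++ evenEntries t)
  let S₁ ← leftist .or (oddEntries t)
  let S : Op → List Tree := fun op => match op with
    | .and => S₀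
    | .or => S₁
  aop ξ S (s.length + t.length) .and s t

/-- The constructed circuit for `n` symmetric inputs (the vertices `0, …, n - 1`) and `m`
alternating inputs (the vertices `n, …, n + m - 1`). -/
noncomputable def aopCircuit (ξ : ℝ) (n m : ℕ) : Circuit :=
  (linearAop ξ (List.range n) ((List.range m).map (n + ·)) ⟨n + m, []⟩).2

end AndOrPath

/-! The cost of an instance is measured by the number `b` of boundary trees of `s`. A symmetric tree
on `K` uses only Huffman gates above the roots of the boundary trees, hence `b(K) - 1` additional
gates, and the gate that attaches it brings this to `b(K)`. The set removed by a symmetric split is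
a union of boundary trees of `s`, so `b` drops by at least the amount paid (`boundaryTrees_split`);
a simple split removes all of `s`. These two splits are therefore free against a bound of the form
`b(s) + g`, with `g` unchanged by the split, and `addsAtMost_aop_succ` reduces everything to base
cases and alternating splits.

An alternating split with prefix length `2 j + 1` costs one gate plus the boundary trees of the new
symmetric inputs. These `j` inputs are consecutive leaves of the dual leftist circuit. An interval
of `N` leaves satisfies `2 ^ (b + 2) ≤ (N + 2) ^ 2` (`two_pow_length_boundaryTrees_le_of_infix`),
whence `b ≤ ρ(N)` (`le_rho`). Since the split occurs only for `m > μ(d - 1, 0)`, the cost is at most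
`ψ(d) m` (`one_add_le_mul_psi`). Both parts have parameter at most `d - 1` (for the second part this
is `sub_le_mu`) and their lengths add up to `m`, so induction yields the factor `2.67 + φ(d)`.

The induction starts at `d ≤ 4`, where the desired bound is `b(s) + m`. Inside the recursion it can
fail by one gate, namely if `n ≤ 1`, `m ≥ 6` and `t₁, t₃` are not siblings (`addsAtMost_aop_small`).
For `d ≥ 5` the slack `ψ(5) ≥ 1/3` absorbs this gate (`addsAtMost_aop_of_five_le`). At top level the
dual leftist circuit starts with `t₁, t₃`, which then form a full tree, so the failure does not
occur (`addsAtMost_aop`). -/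

namespace AndOrPath

/-! ### Counting additional gates -/

/-- Running `p` adds at most `c` additional gates to any circuit. -/
def AddsAtMost {α : Type} (p : Build α) (c : ℝ) : Prop :=
  ∀ C : Circuit, ((p.run C).2.numAdditionalGates : ℝ) ≤ C.numAdditionalGates + c

theorem AddsAtMost.mono {α : Type} {p : Build α} {c c' : ℝ} (h : AddsAtMost p c) (hc : c ≤ c') :
    AddsAtMost p c' := fun C => (h C).trans (by linarith)

theorem AddsAtMost.pure {α : Type} (a : α) {c : ℝ} (hc : 0 ≤ c) :
    AddsAtMost (Pure.pure a) c := fun C => by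
  simp only [StateT.run_pure]
  exact le_add_of_nonneg_right hc

theorem AddsAtMost.bind {α β : Type} {p : Build α} {q : α → Build β} {c₁ c₂ : ℝ}
    (hp : AddsAtMost p c₁) (hq : ∀ a, AddsAtMost (q a) c₂) : AddsAtMost (p >>= q) (c₁ + c₂) :=
  fun C => by
    have h₁ := hp C
    have h₂ := hq (p.run C).1 (p.run C).2
    simp only [StateT.run_bind]
    exact h₂.trans (by linarith)

theorem numAdditionalGates_addGate (kind : GateKind) (op : Op) (u v : ℕ) (C : Circuit) :
    ((addGate kind op u v).run C).2.numAdditionalGates =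
      C.numAdditionalGates + if kind.isAdditional then 1 else 0 := by
  simp only [addGate, StateT.run, Circuit.numAdditionalGates, List.countP_append,
    List.countP_singleton]

theorem addsAtMost_addGate (kind : GateKind) (op : Op) (u v : ℕ) :
    AddsAtMost (addGate kind op u v) 1 := fun C => by
  rw [numAdditionalGates_addGate]
  split_ifs <;> simp

theorem addsAtMost_huffmanSorted (kind : GateKind) (op : Op) (l : List (ℕ × ℕ)) :
    AddsAtMost (huffmanSorted kind op l) ((l.length - 1 : ℕ) : ℝ) := by
  induction h : l.length generalizing l with
  | zero =>
    obtain rfl := List.length_eq_zero_iff.1 h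
    rw [huffmanSorted]
    exact AddsAtMost.pure _ (by simp)
  | succ n ih =>
    match l, h with
    | [x], _ =>
      rw [huffmanSorted]
      exact AddsAtMost.pure _ (by simp)
    | x :: y :: rest, h =>
      rw [huffmanSorted]
      refine ((addsAtMost_addGate _ _ _ _).bind fun v =>
        ih (insertByTime (v, max x.2 y.2 + 1) rest) ?_).mono ?_
      · simpa [length_insertByTime] using h
      · obtain rfl : n = rest.length + 1 := by simpa using h.symm
        push_cast [Nat.add_sub_cancel]
        linarith

theorem length_foldr_insertByTime (l : List (ℕ × ℕ)) :
    (l.foldr insertByTime []).length = l.length := by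
  induction l with
  | nil => rfl
  | cons x l ih => simp [length_insertByTime, ih]

/-- Gates inside the boundary trees belong to the leftist circuit and are free; only the Huffman
joins are paid for. This makes the number of boundary trees the right measure of cost. -/
theorem addsAtMost_symTree (kind : GateKind) (S : Op → List Tree) (op : Op) (K : List ℕ)
    (L : List (ℕ × ℕ)) :
    AddsAtMost (symTree kind S op K L)
      (((boundaryTrees K (S op)).length + L.length - 1 : ℕ) : ℝ) := by
  have h := addsAtMost_huffmanSorted kind op
    (((boundaryTrees K (S op)).map (fun T => (T.root, T.depth)) ++ L).foldr insertByTime [])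
  rw [length_foldr_insertByTime] at h
  simpa [symTree, huffman] using h

/-! ### Full trees and leftist forests -/

/-- All leaves of the tree have the same depth. -/
def Tree.IsFull : Tree → Prop
  | .leaf _ => True
  | .node _ l r => l.depth = r.depth ∧ l.IsFull ∧ r.IsFull

/-- The leaves of a sequence of trees. -/
def leaves (Ts : List Tree) : List ℕ := Ts.flatMap Tree.inputs

@[simp] theorem leaves_nil : leaves [] = [] := rfl

@[simp] theorem leaves_cons (T : Tree) (Ts : List Tree) :
    leaves (T :: Ts) = T.inputs ++ leaves Ts := rfl

/-- Full trees such that each tree has more leaves than all trees to the right of it. -/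
def IsLeftistForest : List Tree → Prop
  | [] => True
  | T :: Ts => T.IsFull ∧ (leaves Ts).length < T.inputs.length ∧ IsLeftistForest Ts

theorem Tree.IsFull.length_inputs {T : Tree} (h : T.IsFull) : T.inputs.length = 2 ^ T.depth := by
  induction T with
  | leaf v => rfl
  | node v l r ihl ihr =>
    obtain ⟨hd, hl, hr⟩ := h
    simp [Tree.inputs, Tree.depth, ihl hl, ihr hr, hd, pow_succ, mul_two]

theorem Tree.inputs_ne_nil (T : Tree) : T.inputs ≠ [] := by
  induction T with
  | leaf v => simp [Tree.inputs]
  | node v l r ihl ihr => simp [Tree.inputs, ihl]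

theorem IsLeftistForest.isFull {Ts : List Tree} (h : IsLeftistForest Ts) :
    ∀ T ∈ Ts, T.IsFull := by
  induction Ts with
  | nil => simp
  | cons T Ts ih =>
    obtain ⟨h₁, -, h₃⟩ := h
    simpa [h₁] using ih h₃

theorem fullTree_spec (op : Op) (k : ℕ) (xs : List ℕ) (hxs : xs.length = 2 ^ k) (C : Circuit) :
    (((fullTree op k xs).run C).1.IsFull ∧ ((fullTree op k xs).run C).1.depth = k ∧
      ((fullTree op k xs).run C).1.inputs = xs) ∧
      ((fullTree op k xs).run C).2.numAdditionalGates = C.numAdditionalGates := by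
  induction k generalizing xs C with
  | zero =>
    obtain ⟨x, rfl⟩ := List.length_eq_one_iff.1 (by simpa using hxs)
    exact ⟨⟨trivial, rfl, rfl⟩, rfl⟩
  | succ k ih =>
    have h₁ : (xs.take (2 ^ k)).length = 2 ^ k := by simp [hxs, pow_succ]
    have h₂ : (xs.drop (2 ^ k)).length = 2 ^ k := by simp [hxs, pow_succ, mul_two]
    obtain ⟨⟨a₁, a₂, a₃⟩, a₄⟩ := ih _ h₁ C
    obtain ⟨⟨b₁, b₂, b₃⟩, b₄⟩ := ih _ h₂ ((fullTree op k (xs.take (2 ^ k))).run C).2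
    refine ⟨⟨⟨a₂.trans b₂.symm, a₁, b₁⟩, ?_, ?_⟩, ?_⟩
    · exact (congrArg₂ (fun a b => max a b + 1) a₂ b₂).trans (by simp)
    · exact (congrArg₂ (· ++ ·) a₃ b₃).trans (List.take_append_drop _ _)
    · exact (numAdditionalGates_addGate _ _ _ _ _).trans (b₄.trans a₄)

theorem leftist_spec (op : Op) (xs : List ℕ) (C : Circuit) :
    (IsLeftistForest ((leftist op xs).run C).1 ∧ leaves ((leftist op xs).run C).1 = xs) ∧
      ((leftist op xs).run C).2.numAdditionalGates = C.numAdditionalGates := by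
  induction h : xs.length using Nat.strong_induction_on generalizing xs C with
  | _ n ih =>
    rw [leftist]
    split_ifs with hxs
    · exact ⟨⟨trivial, hxs.symm⟩, rfl⟩
    · have hpos : xs.length ≠ 0 := by simpa using hxs
      have hle := Nat.pow_log_le_self 2 hpos
      have hlt := Nat.lt_pow_succ_log_self (b := 2) one_lt_two xs.length
      set k := Nat.log 2 xs.length with hk
      have h2 : 0 < 2 ^ k := by positivity
      obtain ⟨⟨a₁, a₂, a₃⟩, a₄⟩ := fullTree_spec op k (xs.take (2 ^ k)) (by simp [hle]) C
      obtain ⟨⟨b₁, b₂⟩, b₃⟩ := ih (xs.drop (2 ^ k)).length (by simp; omega) (xs.drop (2 ^ k))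
        ((fullTree op k (xs.take (2 ^ k))).run C).2 rfl
      refine ⟨⟨⟨a₁, ?_, b₁⟩, ?_⟩, b₃.trans a₄⟩
      -- By maximality of `k`, fewer than `2 ^ k` inputs remain after the first tree.
      · refine (congrArg List.length b₂).trans_lt (lt_of_lt_of_eq ?_ (congrArg List.length a₃).symm)
        rw [pow_succ] at hlt
        simp
        omega
      · exact (congrArg₂ (· ++ ·) a₃ b₂).trans (List.take_append_drop _ _)

/-! ### Boundary trees -/

theorem Tree.boundary_congr {K K' : List ℕ} {T : Tree}
    (h : ∀ x ∈ T.inputs, (x ∈ K ↔ x ∈ K')) : T.boundary K = T.boundary K' := by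
  induction T with
  | leaf v => simp [Tree.boundary, h v (by simp [Tree.inputs])]
  | node v l r ihl ihr =>
    simp only [Tree.inputs, List.mem_append] at h
    have : (∀ x ∈ l.inputs ++ r.inputs, x ∈ K) ↔ (∀ x ∈ l.inputs ++ r.inputs, x ∈ K') :=
      forall₂_congr fun x hx => h x (by simpa using hx)
    simp only [Tree.boundary, this, ihl fun x hx => h x (.inl hx), ihr fun x hx => h x (.inr hx)]

theorem boundaryTrees_congr {K K' : List ℕ} {S : List Tree}
    (h : ∀ x ∈ leaves S, (x ∈ K ↔ x ∈ K')) : boundaryTrees K S = boundaryTrees K' S := by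
  induction S with
  | nil => rfl
  | cons T S ih =>
    simp only [leaves_cons, List.mem_append] at h
    simp only [boundaryTrees, List.flatMap_cons] at ih ⊢
    rw [Tree.boundary_congr fun x hx => h x (.inl hx), ih fun x hx => h x (.inr hx)]

theorem Tree.boundary_eq_singleton {K : List ℕ} {T : Tree} (h : ∀ x ∈ T.inputs, x ∈ K) :
    T.boundary K = [T] := by
  cases T with
  | leaf v => simpa [Tree.boundary, Tree.inputs] using h
  | node v l r => exact if_pos h

theorem Tree.boundary_eq_nil {K : List ℕ} {T : Tree} (h : ∀ x ∈ T.inputs, x ∉ K) :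
    T.boundary K = [] := by
  induction T with
  | leaf v => simpa [Tree.boundary, Tree.inputs] using h
  | node v l r ihl ihr =>
    simp only [Tree.inputs, List.mem_append] at h
    rw [Tree.boundary, if_neg, ihl fun x hx => h x (.inl hx), ihr fun x hx => h x (.inr hx)]
    · rfl
    · intro H
      obtain ⟨x, hx⟩ := List.exists_mem_of_ne_nil _ l.inputs_ne_nil
      exact h x (.inl hx) (H x (by simp [hx]))

theorem boundaryTrees_cons (K : List ℕ) (T : Tree) (S : List Tree) :
    boundaryTrees K (T :: S) = T.boundary K ++ boundaryTrees K S := rfl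

theorem boundaryTrees_eq_nil {K : List ℕ} {S : List Tree} (h : ∀ x ∈ leaves S, x ∉ K) :
    boundaryTrees K S = [] := by
  induction S with
  | nil => rfl
  | cons T S ih =>
    simp only [leaves_cons, List.mem_append] at h
    rw [boundaryTrees_cons, Tree.boundary_eq_nil fun x hx => h x (.inl hx),
      ih fun x hx => h x (.inr hx)]
    rfl

/-- At a node that is not completely covered, `v` lies below only one child, so the other child
contributes as before. A node that becomes covered contributes a single tree. -/
theorem Tree.length_boundary_append_singleton_le {T : Tree} (hT : T.inputs.Nodup) (K : List ℕ)
    (v : ℕ) : (T.boundary (K ++ [v])).length ≤ (T.boundary K).length + 1 := by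
  induction T with
  | leaf w =>
    simp only [Tree.boundary]
    split_ifs <;> simp
  | node w l r ihl ihr =>
    obtain ⟨hl, hr, hlr⟩ := List.nodup_append'.1 hT
    rw [Tree.boundary]
    split_ifs with h
    · simp
    · rw [Tree.boundary, if_neg fun H => h fun x hx => by simp [H x hx]]
      have key : ∀ U : Tree, v ∉ U.inputs → U.boundary (K ++ [v]) = U.boundary K := fun U hU =>
        Tree.boundary_congr fun x hx => by
          have : x ≠ v := fun e => hU (e ▸ hx)
          simp [this]
      simp only [List.length_append]
      by_cases hv : v ∈ l.inputs
      · rw [key r (hlr hv)]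
        have := ihl hl
        omega
      · rw [key l hv]
        have := ihr hr
        omega

theorem length_boundaryTrees_append_singleton_le {S : List Tree} (hS : (leaves S).Nodup)
    (K : List ℕ) (v : ℕ) :
    (boundaryTrees (K ++ [v]) S).length ≤ (boundaryTrees K S).length + 1 := by
  induction S with
  | nil => simp [boundaryTrees]
  | cons T S ih =>
    obtain ⟨hl, hr, hlr⟩ := List.nodup_append'.1 hS
    simp only [boundaryTrees_cons, List.length_append]
    by_cases hv : v ∈ leaves S
    · rw [Tree.boundary_congr (K' := K) fun x hx => by
        have : x ≠ v := fun e => hlr hx (e ▸ hv)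
        simp [this]]
      have := ih hr
      omega
    · rw [boundaryTrees_congr (K := K ++ [v]) (K' := K) fun x hx => by
        have : x ≠ v := fun e => hv (e ▸ hx)
        simp [this]]
      have := Tree.length_boundary_append_singleton_le hl K v
      omega

/-- Shrinking `K` to a union of boundary trees keeps those trees maximal: every node above them has
a leaf outside `K`, hence outside `K'`. -/
theorem Tree.boundary_eq_filter {K K' : List ℕ} {T : Tree}
    (hsub : ∀ x ∈ T.inputs, x ∈ K' → x ∈ K)
    (h : ∀ U ∈ T.boundary K, (∀ x ∈ U.inputs, x ∈ K') ∨ ∀ x ∈ U.inputs, x ∉ K') :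
    T.boundary K' = (T.boundary K).filter fun U => ∀ x ∈ U.inputs, x ∈ K' := by
  by_cases hT : ∀ x ∈ T.inputs, x ∈ K
  · rw [Tree.boundary_eq_singleton hT] at h ⊢
    rcases h T (by simp) with h | h
    · rw [Tree.boundary_eq_singleton h, List.filter_cons_of_pos (by simpa using h)]
      rfl
    · obtain ⟨x, hx⟩ := List.exists_mem_of_ne_nil _ T.inputs_ne_nil
      rw [Tree.boundary_eq_nil h, List.filter_cons_of_neg]
      · rfl
      · simpa using ⟨x, hx, h x hx⟩
  · cases T with
    | leaf v =>
      simp only [Tree.inputs, List.mem_singleton, forall_eq] at hT hsub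
      simp [Tree.boundary, hT, mt hsub hT]
    | node v l r =>
      have hK : (Tree.node v l r).boundary K = l.boundary K ++ r.boundary K := if_neg hT
      have hK' : (Tree.node v l r).boundary K' = l.boundary K' ++ r.boundary K' :=
        if_neg fun H => hT fun x hx => hsub x hx (H x hx)
      rw [hK] at h
      simp only [Tree.inputs, List.mem_append] at h hsub
      rw [hK, hK', List.filter_append,
        ← Tree.boundary_eq_filter (fun x hx => hsub x (.inl hx)) fun V hV => h V (.inl hV),
        ← Tree.boundary_eq_filter (fun x hx => hsub x (.inr hx)) fun V hV => h V (.inr hV)]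

theorem boundaryTrees_eq_filter {K K' : List ℕ} {S : List Tree} (hsub : K' ⊆ K)
    (h : ∀ U ∈ boundaryTrees K S, (∀ x ∈ U.inputs, x ∈ K') ∨ ∀ x ∈ U.inputs, x ∉ K') :
    boundaryTrees K' S = (boundaryTrees K S).filter fun U => ∀ x ∈ U.inputs, x ∈ K' := by
  induction S with
  | nil => rfl
  | cons T S ih =>
    simp only [boundaryTrees_cons, List.mem_append] at h ⊢
    rw [List.filter_append, ← ih fun U hU => h U (.inr hU),
      Tree.boundary_eq_filter (fun x _ hx => hsub hx) fun U hU => h U (.inl hU)]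

theorem Tree.isFull_of_mem_boundary {K : List ℕ} {T : Tree} (hT : T.IsFull) :
    ∀ U ∈ T.boundary K, U.IsFull := by
  induction T with
  | leaf v =>
    intro U hU
    simp only [Tree.boundary] at hU
    split_ifs at hU with h <;> simp at hU
    subst hU
    trivial
  | node v l r ihl ihr =>
    intro U hU
    rw [Tree.boundary] at hU
    split_ifs at hU with h
    · obtain rfl := List.mem_singleton.1 hU
      exact hT
    · rcases List.mem_append.1 hU with hU | hU
      exacts [ihl hT.2.1 U hU, ihr hT.2.2 U hU]

/-- The leaves of the boundary trees of `K` are the leaves in `K`. -/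
theorem Tree.leaves_boundary (K : List ℕ) (T : Tree) :
    leaves (T.boundary K) = T.inputs.filter fun x => x ∈ K := by
  induction T with
  | leaf v =>
    simp only [Tree.boundary, Tree.inputs, List.filter_singleton]
    split_ifs with h <;> simp [h, Tree.inputs]
  | node v l r ihl ihr =>
    rw [Tree.boundary]
    split_ifs with h
    · rw [leaves_cons, leaves_nil, List.append_nil, eq_comm, List.filter_eq_self]
      simpa [Tree.inputs] using h
    · simp only [leaves] at ihl ihr ⊢
      rw [List.flatMap_append, ihl, ihr, Tree.inputs, List.filter_append]

theorem leaves_boundaryTrees (K : List ℕ) (S : List Tree) :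
    leaves (boundaryTrees K S) = (leaves S).filter fun x => x ∈ K := by
  induction S with
  | nil => rfl
  | cons T S ih =>
    rw [boundaryTrees_cons, leaves_cons, List.filter_append, ← ih, ← Tree.leaves_boundary]
    simp [leaves]

/-! ### Triangular subsets -/

theorem length_leaves_boundaryTrees {S : List Tree} {N : List ℕ} (hS : (leaves S).Nodup)
    (hN : N.Nodup) (hNS : N ⊆ leaves S) : (leaves (boundaryTrees N S)).length = N.length := by
  rw [leaves_boundaryTrees]
  refine List.Perm.length_eq ((List.perm_ext_iff_of_nodup (hS.filter _) hN).2 fun x => ?_)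
  simpa using fun hx => hNS hx

theorem isFull_of_mem_boundaryTrees {S : List Tree} {N : List ℕ} (hS : ∀ T ∈ S, T.IsFull) :
    ∀ U ∈ boundaryTrees N S, U.IsFull := fun U hU => by
  obtain ⟨T, hT, hU⟩ := List.mem_flatMap.1 hU
  exact Tree.isFull_of_mem_boundary (hS T hT) U hU

theorem length_leaves_eq_sum {Ts : List Tree} (h : ∀ T ∈ Ts, T.IsFull) :
    (leaves Ts).length = ((Ts.map Tree.depth).map (2 ^ ·)).sum := by
  rw [leaves, List.length_flatMap, List.map_map]
  exact congrArg List.sum (List.map_congr_left fun T hT => (h T hT).length_inputs)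

theorem sum_two_pow_lt {l : List ℕ} (hl : l.Nodup) {L : ℕ} (h : ∀ x ∈ l, x < L) :
    (l.map (2 ^ ·)).sum < 2 ^ L := by
  rw [← List.sum_toFinset _ hl]
  exact Nat.geomSum_lt le_rfl fun x hx => h x (List.mem_toFinset.1 hx)

/-- Otherwise the sizes would be distinct powers of two below `2 ^ Nat.log 2 N`, with `N` the number
of leaves, and their sum would be less than `N`. -/
theorem exists_count_depth_ge_two {Ts : List Tree} (h : ∀ T ∈ Ts, T.IsFull)
    (hne : (leaves Ts).length ≠ 0)
    (hd : ∀ T ∈ Ts, T.depth ≠ Nat.log 2 (leaves Ts).length) :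
    ∃ e ∈ Ts.map Tree.depth, 2 ≤ (Ts.map Tree.depth).count e := by
  by_contra! H
  have hnd : (Ts.map Tree.depth).Nodup := by
    rw [List.nodup_iff_count_le_one]
    intro a
    by_cases ha : a ∈ Ts.map Tree.depth
    · exact Nat.lt_succ_iff.1 (H a ha)
    · simp [List.count_eq_zero_of_not_mem ha]
  have hlt : ∀ x ∈ Ts.map Tree.depth, x < Nat.log 2 (leaves Ts).length := by
    intro x hx
    obtain ⟨T, hT, rfl⟩ := List.mem_map.1 hx
    refine lt_of_le_of_ne (Nat.le_log_of_pow_le one_lt_two ?_) (hd T hT)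
    rw [← (h T hT).length_inputs]
    rw [leaves, List.length_flatMap]
    exact List.single_le_sum (by simp) _ (List.mem_map_of_mem hT)
  have h₁ := sum_two_pow_lt hnd hlt
  rw [← length_leaves_eq_sum h] at h₁
  exact absurd (Nat.pow_log_le_self 2 hne) (not_le.2 h₁)

theorem foldr_max_mem {l : List ℕ} (hl : l ≠ []) : l.foldr max 0 ∈ l := by
  induction l with
  | nil => exact absurd rfl hl
  | cons a l ih =>
    rcases eq_or_ne l [] with rfl | h
    · simp
    · rcases max_choice a (l.foldr max 0) with h' | h'
      · simp [List.foldr_cons, h']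
      · rw [List.foldr_cons, h']
        exact List.mem_cons_of_mem _ (ih h)

/-- The triangular subset consists of the inputs of some boundary trees. -/
theorem exists_triangularSubset_eq_leaves {S : List Tree} {N : List ℕ}
    (hfull : ∀ T ∈ S, T.IsFull) (hS : (leaves S).Nodup) (hN : N.Nodup) (hNS : N ⊆ leaves S)
    (hne : N ≠ []) :
    ∃ Us, Us ≠ [] ∧ Us ⊆ boundaryTrees N S ∧ triangularSubset S N = leaves Us := by
  have hlen := length_leaves_boundaryTrees hS hN hNS
  have hTs := isFull_of_mem_boundaryTrees (N := N) hfull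
  rw [triangularSubset]
  set Ts := boundaryTrees N S
  dsimp only
  split
  · next T hT =>
    exact ⟨[T], by simp, by simpa using List.mem_of_find?_eq_some hT, by simp⟩
  · next hT =>
    refine ⟨_, ?_, ?_, rfl⟩
    · obtain ⟨e, he, he'⟩ := exists_count_depth_ge_two hTs (by simpa [hlen] using hne) (by
        simpa [hlen] using hT)
      set D := ((Ts.map Tree.depth).filter fun e =>
        decide (2 ≤ (Ts.map Tree.depth).count e)).foldr max 0 with hD
      have hDmem : D ∈ Ts.map Tree.depth := by
        refine List.mem_of_mem_filter (foldr_max_mem (List.ne_nil_of_mem (a := e) ?_))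
        simpa using ⟨List.mem_map.1 he, he'⟩
      obtain ⟨T, hTmem, hTD⟩ := List.mem_map.1 hDmem
      -- A tree of depth `D` exists, so the trimming from the left stops at one, and this tree also
      -- survives the trimming from the right.
      have h₁ : Ts.dropWhile (fun T => decide (T.depth ≠ D)) ≠ [] := fun H => by
        have := List.dropWhile_eq_nil_iff.1 H T hTmem
        simp [hTD] at this
      intro H
      have h₂ := List.rdropWhile_eq_nil_iff.1 H _ (List.head_mem h₁)
      have h₃ := List.head_dropWhile_not (fun T : Tree => decide (T.depth ≠ D)) h₁
      rw [h₂] at h₃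
      exact absurd h₃ (by simp)
    · exact fun U hU => (List.dropWhile_sublist _).subset
        ((List.rdropWhile_prefix _ _).subset hU)

/-- Splitting off some boundary trees splits the boundary tree sequence. -/
theorem boundaryTrees_split {S : List Tree} {N : List ℕ} (hS : (leaves S).Nodup)
    {Us : List Tree} (hne : Us ≠ []) (hUs : Us ⊆ boundaryTrees N S) :
    1 ≤ (boundaryTrees (leaves Us) S).length ∧
      (boundaryTrees (leaves Us) S).length +
        (boundaryTrees (N.filter fun x => x ∉ leaves Us) S).length ≤
          (boundaryTrees N S).length := by
  have hnd : (leaves (boundaryTrees N S)).Nodup := by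
    rw [leaves_boundaryTrees]
    exact hS.filter _
  have hN : ∀ U ∈ boundaryTrees N S, ∀ x ∈ U.inputs, x ∈ N := fun U hU x hx => by
    have : x ∈ leaves (boundaryTrees N S) := List.mem_flatMap.2 ⟨U, hU, hx⟩
    rw [leaves_boundaryTrees] at this
    simpa using List.of_mem_filter this
  have hdich : ∀ U ∈ boundaryTrees N S,
      (∀ x ∈ U.inputs, x ∈ leaves Us) ∨ ∀ x ∈ U.inputs, x ∉ leaves Us := by
    intro U hU
    by_cases h : U ∈ Us
    · exact .inl fun x hx => List.mem_flatMap.2 ⟨U, h, hx⟩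
    · refine .inr fun x hx hx' => ?_
      obtain ⟨V, hV, hxV⟩ := List.mem_flatMap.1 hx'
      have hpw := (List.nodup_flatMap.1 hnd).2
      have hUV : V ≠ U := fun e => h (e ▸ hV)
      have : Std.Symm (Function.onFun List.Disjoint Tree.inputs) := ⟨fun _ _ h => h.symm⟩
      exact hpw.forall (hUs hV) hU hUV hxV hx
  have hsub : leaves Us ⊆ N := fun x hx => by
    obtain ⟨V, hV, hxV⟩ := List.mem_flatMap.1 hx
    exact hN V (hUs hV) x hxV
  rw [boundaryTrees_eq_filter hsub hdich]
  refine ⟨?_, ?_⟩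
  · obtain ⟨U, hU⟩ := List.exists_mem_of_ne_nil _ hne
    refine List.length_pos_of_mem (a := U) (List.mem_filter.2 ⟨hUs hU, ?_⟩)
    exact decide_eq_true fun x hx => List.mem_flatMap.2 ⟨U, hU, hx⟩
  · rw [boundaryTrees_eq_filter (K' := N.filter fun x => x ∉ leaves Us) (List.filter_subset_self _)
      fun U hU => (hdich U hU).symm.imp (fun h x hx => by simpa using ⟨hN U hU x hx, h x hx⟩)
        fun h x hx => by simpa using fun _ => h x hx]
    rw [← List.countP_eq_length_filter, ← List.countP_eq_length_filter,
      List.length_eq_countP_add_countP (fun U : Tree => decide (∀ x ∈ U.inputs, x ∈ leaves Us))]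
    -- A tree kept for the complement has a leaf outside `leaves Us`, so no tree is counted on both
    -- sides.
    refine Nat.add_le_add_left (List.countP_mono_left fun U _ h => ?_) _
    obtain ⟨x, hx⟩ := List.exists_mem_of_ne_nil _ U.inputs_ne_nil
    simp only [decide_eq_true_eq, List.mem_filter] at h ⊢
    exact fun H => (h x hx).2 (H x hx)

/-! ### Boundary trees of intervals -/

theorem Tree.length_boundary_node_le (K : List ℕ) (v : ℕ) (l r : Tree) :
    ((Tree.node v l r).boundary K).length ≤ (l.boundary K).length + (r.boundary K).length := by
  by_cases h : ∀ x ∈ (Tree.node v l r).inputs, x ∈ K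
  · rw [Tree.boundary_eq_singleton h,
      Tree.boundary_eq_singleton fun x hx => h x (List.mem_append_left _ hx)]
    simp
  · exact ((congrArg List.length (if_neg h)).trans List.length_append).le

/-- A proper prefix decomposes into full trees of strictly decreasing sizes, as in a binary
expansion, so `b` trees have at least `2 ^ b - 1` leaves. -/
theorem Tree.two_pow_length_boundary_le_of_prefix {T : Tree} (hT : T.IsFull)
    (hnd : T.inputs.Nodup) {I : List ℕ} (hI : I <+: T.inputs) :
    2 ^ (T.boundary I).length ≤ I.length + 1 := by
  -- The full tree is treated before the induction, so that the induction hypothesis concerns proper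
  -- prefixes only. In the right subtree these are shorter than the left subtree, which pays for the
  -- doubling caused by the additional left tree.
  by_cases hall : I = T.inputs
  · subst hall
    rw [Tree.boundary_eq_singleton fun _ h => h]
    have := List.length_pos_of_ne_nil T.inputs_ne_nil
    simp
    omega
  induction T generalizing I with
  | leaf v =>
    have : I = [] := by
      rcases List.prefix_cons_iff.1 hI with h | ⟨t, rfl, ht⟩
      · exact h
      · simp [Tree.inputs, List.prefix_nil.1 ht] at hall
    subst this
    simp [Tree.boundary]
  | node v l r ihl ihr =>
    obtain ⟨hl, hr, hlr⟩ := List.nodup_append'.1 hnd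
    have hnode := Tree.length_boundary_node_le I v l r
    obtain ⟨B, hB⟩ := hI
    have hlen : l.inputs.length = r.inputs.length := by
      rw [hT.2.1.length_inputs, hT.2.2.length_inputs, hT.1]
    have hpos := List.length_pos_of_ne_nil l.inputs_ne_nil
    rcases List.append_eq_append_iff.1 hB with ⟨a, ha, -⟩ | ⟨c, hc, hc'⟩
    · have hIl : I <+: l.inputs := ⟨a, ha.symm⟩
      rw [Tree.boundary_eq_nil (T := r) fun x hx hx' => hlr (hIl.subset hx') hx] at hnode
      refine (Nat.pow_le_pow_right two_pos hnode).trans ?_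
      by_cases h : I = l.inputs
      · subst h
        rw [Tree.boundary_eq_singleton fun _ h => h]
        simp
        omega
      · simpa using ihl hT.2.1 hl hIl h
    · have hcr : c <+: r.inputs := ⟨B, hc'.symm⟩
      have hne : c ≠ r.inputs := fun h => hall (by rw [hc, h]; rfl)
      have ih := ihr hT.2.2 hr hcr hne
      have hclt : c.length < r.inputs.length :=
        lt_of_le_of_ne hcr.length_le fun h => hne (hcr.eq_of_length h)
      rw [Tree.boundary_eq_singleton (T := l) fun x hx => by simp [hc, hx],
        Tree.boundary_congr (T := r) (K' := c) fun x hx => by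
          have : x ∉ l.inputs := fun h => hlr h hx
          simp [hc, this]] at hnode
      refine (Nat.pow_le_pow_right two_pos hnode).trans ?_
      simp only [List.length_singleton, hc, List.length_append, pow_add]
      omega

theorem Tree.two_pow_length_boundary_le_of_suffix {T : Tree} (hT : T.IsFull)
    (hnd : T.inputs.Nodup) {I : List ℕ} (hI : I <:+ T.inputs) :
    2 ^ (T.boundary I).length ≤ I.length + 1 := by
  by_cases hall : I = T.inputs
  · subst hall
    rw [Tree.boundary_eq_singleton fun _ h => h]
    have := List.length_pos_of_ne_nil T.inputs_ne_nil
    simp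
    omega
  induction T generalizing I with
  | leaf v =>
    have : I = [] := by
      rcases List.suffix_cons_iff.1 hI with h | h
      · exact absurd h hall
      · exact List.suffix_nil.1 h
    subst this
    simp [Tree.boundary]
  | node v l r ihl ihr =>
    obtain ⟨hl, hr, hlr⟩ := List.nodup_append'.1 hnd
    have hnode := Tree.length_boundary_node_le I v l r
    obtain ⟨B, hB⟩ := hI
    have hlen : l.inputs.length = r.inputs.length := by
      rw [hT.2.1.length_inputs, hT.2.2.length_inputs, hT.1]
    have hpos := List.length_pos_of_ne_nil l.inputs_ne_nil
    rcases List.append_eq_append_iff.1 hB with ⟨c, hc', hc⟩ | ⟨a, -, ha⟩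
    · have hcl : c <:+ l.inputs := ⟨B, hc'.symm⟩
      have hne : c ≠ l.inputs := fun h => hall (by rw [hc, h]; rfl)
      have ih := ihl hT.2.1 hl hcl hne
      have hclt : c.length < l.inputs.length :=
        lt_of_le_of_ne hcl.length_le fun h => hne (hcl.eq_of_length h)
      rw [Tree.boundary_eq_singleton (T := r) fun x hx => by simp [hc, hx],
        Tree.boundary_congr (T := l) (K' := c) fun x hx => by
          have : x ∉ r.inputs := fun h => hlr hx h
          simp [hc, this]] at hnode
      refine (Nat.pow_le_pow_right two_pos hnode).trans ?_
      simp only [List.length_singleton, hc, List.length_append, pow_add]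
      omega
    · have hIr : I <:+ r.inputs := ⟨a, ha.symm⟩
      rw [Tree.boundary_eq_nil (T := l) fun x hx hx' => hlr hx (hIr.subset hx')] at hnode
      refine (Nat.pow_le_pow_right two_pos hnode).trans ?_
      by_cases h : I = r.inputs
      · subst h
        rw [Tree.boundary_eq_singleton fun _ h => h]
        simp
        omega
      · simpa using ihr hT.2.2 hr hIr h

/-- If the prefix contains the first tree, one more boundary tree doubles the left side; the first
tree outweighs everything to its right, so the right side doubles as well. -/
theorem two_pow_length_boundaryTrees_le_of_prefix {S : List Tree} (hS : IsLeftistForest S)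
    (hnd : (leaves S).Nodup) {I : List ℕ} (hI : I <+: leaves S) :
    2 ^ (boundaryTrees I S).length ≤ I.length + 1 := by
  induction S generalizing I with
  | nil => simp [boundaryTrees]
  | cons T S ih =>
    rw [leaves_cons] at hnd hI
    obtain ⟨hl, hr, hlr⟩ := List.nodup_append'.1 hnd
    obtain ⟨hT, hlt, hS⟩ := hS
    rw [boundaryTrees_cons, List.length_append]
    obtain ⟨B, hB⟩ := hI
    rcases List.append_eq_append_iff.1 hB with ⟨a, ha, -⟩ | ⟨c, hc, hc'⟩
    · have hIl : I <+: T.inputs := ⟨a, ha.symm⟩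
      rw [boundaryTrees_eq_nil fun x hx hx' => hlr (hIl.subset hx') hx]
      exact Tree.two_pow_length_boundary_le_of_prefix hT hl hIl
    · have hcr : c <+: leaves S := ⟨B, hc'.symm⟩
      have := ih hS hr hcr
      have := hcr.length_le
      rw [Tree.boundary_eq_singleton (T := T) fun x hx => by simp [hc, hx],
        boundaryTrees_congr (S := S) (K' := c) fun x hx => by
          have : x ∉ T.inputs := fun h => hlr h hx
          simp [hc, this]]
      simp only [List.length_singleton, hc, List.length_append, pow_add]
      omega

/-- This is the inequality `4 x y ≤ (x + y) ^ 2` with `x = p + 1` and `y = q + 1`, for an interval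
cut into a suffix and a prefix. -/
theorem two_pow_add_two_le {a b c e p q : ℕ} (h : c ≤ a + b) (ha : 2 ^ a ≤ p + 1)
    (hb : 2 ^ b ≤ q + 1) (he : e = p + q) : 2 ^ (c + 2) ≤ (e + 2) ^ 2 := by
  subst he
  calc 2 ^ (c + 2) ≤ 2 ^ (a + b + 2) := Nat.pow_le_pow_right two_pos (by omega)
    _ = 4 * (2 ^ a * 2 ^ b) := by ring
    _ ≤ 4 * ((p + 1) * (q + 1)) := by gcongr
    _ ≤ (p + q + 2) ^ 2 := by
      zify
      nlinarith [sq_nonneg ((p : ℤ) - q)]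

/-- At the node where the interval first meets both children, it splits into a suffix of the left
and a prefix of the right subtree. -/
theorem Tree.two_pow_length_boundary_le_of_infix {T : Tree} (hT : T.IsFull)
    (hnd : T.inputs.Nodup) {I : List ℕ} (hI : I <:+: T.inputs) :
    2 ^ ((T.boundary I).length + 2) ≤ (I.length + 2) ^ 2 := by
  induction T with
  | leaf v =>
    by_cases hv : v ∈ I
    · have := List.length_pos_of_mem hv
      simp only [Tree.boundary, if_pos hv, List.length_singleton]
      exact le_trans (by norm_num) (Nat.pow_le_pow_left (show 3 ≤ I.length + 2 by omega) 2)
    · simp only [Tree.boundary, if_neg hv, List.length_nil]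
      exact Nat.pow_le_pow_left (Nat.le_add_left 2 _) 2
  | node v l r ihl ihr =>
    obtain ⟨hl, hr, hlr⟩ := List.nodup_append'.1 hnd
    have hnode := Tree.length_boundary_node_le I v l r
    obtain ⟨A, B, hB⟩ := hI
    rcases List.append_eq_append_iff.1 hB with ⟨a, ha, -⟩ | ⟨c, hc, hc'⟩
    · have hIl : I <:+: l.inputs := ⟨A, a, ha.symm⟩
      rw [Tree.boundary_eq_nil (T := r) fun x hx hx' => hlr (hIl.subset hx') hx] at hnode
      exact (Nat.pow_le_pow_right two_pos (Nat.add_le_add_right hnode 2)).trans (ihl hT.2.1 hl hIl)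
    · rcases List.append_eq_append_iff.1 hc with ⟨e, he, he'⟩ | ⟨e, -, he⟩
      · refine two_pow_add_two_le hnode (p := e.length) (q := c.length) ?_ ?_ (by simp [he'])
        · rw [Tree.boundary_congr (K' := e) fun x hx => by
            have : x ∉ c := fun h => hlr hx (hc' ▸ List.mem_append_left _ h)
            simp [he', this]]
          exact Tree.two_pow_length_boundary_le_of_suffix hT.2.1 hl ⟨A, he.symm⟩
        · rw [Tree.boundary_congr (K' := c) fun x hx => by
            have : x ∉ e := fun h => hlr (he ▸ List.mem_append_right _ h) hx
            simp [he', this]]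
          exact Tree.two_pow_length_boundary_le_of_prefix hT.2.2 hr ⟨B, hc'.symm⟩
      · have hIr : I <:+: r.inputs := ⟨e, B, by rw [hc', he]⟩
        rw [Tree.boundary_eq_nil (T := l) fun x hx hx' => hlr hx (hIr.subset hx'),
          List.length_nil, zero_add] at hnode
        exact (Nat.pow_le_pow_right two_pos (Nat.add_le_add_right hnode 2)).trans
          (ihr hT.2.2 hr hIr)

theorem two_pow_length_boundaryTrees_le_of_infix {S : List Tree} (hS : IsLeftistForest S)
    (hnd : (leaves S).Nodup) {I : List ℕ} (hI : I <:+: leaves S) :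
    2 ^ ((boundaryTrees I S).length + 2) ≤ (I.length + 2) ^ 2 := by
  induction S with
  | nil =>
    exact Nat.pow_le_pow_left (Nat.le_add_left 2 _) 2
  | cons T S ih =>
    rw [leaves_cons] at hnd hI
    obtain ⟨hl, hr, hlr⟩ := List.nodup_append'.1 hnd
    obtain ⟨hT, hlt, hS⟩ := hS
    rw [boundaryTrees_cons, List.length_append]
    obtain ⟨A, B, hB⟩ := hI
    rcases List.append_eq_append_iff.1 hB with ⟨a, ha, -⟩ | ⟨c, hc, hc'⟩
    · have hIl : I <:+: T.inputs := ⟨A, a, ha.symm⟩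
      rw [boundaryTrees_eq_nil fun x hx hx' => hlr (hIl.subset hx') hx]
      exact Tree.two_pow_length_boundary_le_of_infix hT hl hIl
    · rcases List.append_eq_append_iff.1 hc with ⟨e, he, he'⟩ | ⟨e, -, he⟩
      · refine two_pow_add_two_le le_rfl (p := e.length) (q := c.length) ?_ ?_ (by simp [he'])
        · rw [Tree.boundary_congr (K' := e) fun x hx => by
            have : x ∉ c := fun h => hlr hx (hc' ▸ List.mem_append_left _ h)
            simp [he', this]]
          exact Tree.two_pow_length_boundary_le_of_suffix hT hl ⟨A, he.symm⟩
        · rw [boundaryTrees_congr (K' := c) fun x hx => by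
            have : x ∉ e := fun h => hlr (he ▸ List.mem_append_right _ h) hx
            simp [he', this]]
          exact two_pow_length_boundaryTrees_le_of_prefix hS hr ⟨B, hc'.symm⟩
      · have hIr : I <:+: leaves S := ⟨e, B, by rw [hc', he]⟩
        rw [Tree.boundary_eq_nil (T := T) fun x hx hx' => hlr hx (hIr.subset hx'),
          List.length_nil, zero_add]
        exact ih hS hr hIr

/-- An interval of length `N` whose number `b` of boundary trees satisfies
`2 ^ (b + 2) ≤ (N + 2) ^ 2` has at most `ρ(N)` boundary trees. -/
theorem le_rho {b N : ℕ} (h : 2 ^ (b + 2) ≤ (N + 2) ^ 2) : (b : ℝ) ≤ rho N := by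
  rw [rho]
  split_ifs with hN
  · by_contra! H
    have H : N + 1 ≤ b := by exact_mod_cast H
    have h₁ : 2 ^ (N + 3) ≤ (N + 2) ^ 2 := (Nat.pow_le_pow_right two_pos (by omega)).trans h
    interval_cases N <;> norm_num at h₁
  · have hN3 : 3 ≤ N := by omega
    have hNr : (3 : ℝ) ≤ N := by exact_mod_cast hN3
    -- For `N ≥ 4` one has `N + 2 ≤ 2 (N - 1)`. For `N = 3` this fails, but `25 < 2 ^ 5` still gives
    -- `b ≤ 2`.
    have hpow : 2 ^ b ≤ (N - 1) ^ 2 := by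
      rcases eq_or_lt_of_le hN3 with rfl | hN4
      · have hb : b + 2 < 5 := by
          by_contra! H
          have := (Nat.pow_le_pow_right two_pos H).trans h
          norm_num at this
        have : b ≤ 2 := by omega
        exact (Nat.pow_le_pow_right two_pos this).trans (by norm_num)
      · obtain ⟨M, rfl⟩ : ∃ M, N = M + 1 := ⟨N - 1, by omega⟩
        rw [pow_add] at h
        simp only [Nat.add_sub_cancel]
        nlinarith
    have hcast : ((N - 1 : ℕ) : ℝ) = (N : ℝ) - 1 := by
      rw [Nat.cast_sub (by omega), Nat.cast_one]
    have hpow' : (2 : ℝ) ^ b ≤ ((N : ℝ) - 1) ^ 2 := by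
      rw [← hcast]
      exact_mod_cast hpow
    have hlog : (b : ℝ) ≤ 2 * Real.logb 2 ((N : ℝ) - 1) := by
      have h₂ := Real.logb_le_logb_of_le one_lt_two (by positivity) hpow'
      rw [Real.logb_pow, Real.logb_pow, Real.logb_self_eq_one one_lt_two] at h₂
      simpa using h₂
    have : ((b : ℤ) : ℝ) ≤ (⌊2 * Real.logb 2 ((N : ℝ) - 1)⌋ : ℤ) :=
      Int.cast_le.2 (Int.le_floor.2 (by exact_mod_cast hlog))
    exact_mod_cast this

/-! ### The numerical parameters -/

theorem mu_anti {ξ : ℝ} (hξ : 0 ≤ ξ) (d : ℕ) {n n' : ℕ} (h : n' ≤ n) :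
    mu ξ d n ≤ mu ξ d n' := by
  have : (n' : ℝ) ≤ n := by exact_mod_cast h
  unfold mu
  gcongr

theorem mu_three (ξ : ℝ) (n : ℕ) : mu ξ 3 n = ξ * (6 - n) / 3 + 2 := by
  rw [mu]
  push_cast
  ring

theorem mu_four (ξ : ℝ) (n : ℕ) : mu ξ 4 n = ξ * (14 - n) / 4 + 2 := by
  rw [mu]
  push_cast
  ring

theorem sq_le_two_pow (d : ℕ) (hd : 4 ≤ d) : d ^ 2 ≤ 2 ^ d := by
  induction d, hd using Nat.le_induction with
  | base => norm_num
  | succ d hd ih =>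
    rw [pow_succ 2 d]
    nlinarith

theorem dMin_spec {ξ : ℝ} (hξ : 1 ≤ ξ) (n m : ℕ) :
    1 ≤ dMin ξ n m ∧ (m : ℝ) ≤ mu ξ (dMin ξ n m) n := by
  refine Nat.sInf_mem (s := {d : ℕ | 1 ≤ d ∧ (m : ℝ) ≤ mu ξ d n}) ⟨n + m + 4, by omega, ?_⟩
  have h : (n + m + 4) * m + n + 2 ≤ 2 ^ (n + m + 4) :=
    le_trans (by nlinarith) (sq_le_two_pow _ (by omega))
  have h' : ((n + m + 4 : ℕ) : ℝ) * m ≤ (2 : ℝ) ^ (n + m + 4) - n - 2 := by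
    have : (((n + m + 4) * m + n + 2 : ℕ) : ℝ) ≤ ((2 ^ (n + m + 4) : ℕ) : ℝ) := by exact_mod_cast h
    push_cast at this ⊢
    linarith
  have h₀ : (0 : ℝ) ≤ ((n + m + 4 : ℕ) : ℝ) * m := by positivity
  rw [mu]
  refine le_add_of_le_of_nonneg ((le_div_iff₀ (by positivity)).2 ?_) zero_le_two
  nlinarith

theorem dMin_le {ξ : ℝ} {n m d : ℕ} (hd : 1 ≤ d) (h : (m : ℝ) ≤ mu ξ d n) : dMin ξ n m ≤ d :=
  Nat.sInf_le ⟨hd, h⟩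

theorem mu_lt_of_lt_dMin {ξ : ℝ} {n m d : ℕ} (hd : 1 ≤ d) (h : d < dMin ξ n m) :
    mu ξ d n < m := by
  by_contra! H
  exact absurd (dMin_le hd H) (not_le.2 h)

theorem dMin_mono {ξ : ℝ} (hξ : 1 ≤ ξ) (m : ℕ) {n n' : ℕ} (h : n' ≤ n) :
    dMin ξ n' m ≤ dMin ξ n m :=
  dMin_le (dMin_spec hξ n m).1 ((dMin_spec hξ n m).2.trans (mu_anti (by linarith) _ h))

theorem le_five_of_dMin_le_three {ξ : ℝ} (hξ₁ : 1 ≤ ξ) (hξ₂ : ξ < 2) {n m : ℕ}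
    (h : dMin ξ n m ≤ 3) : m ≤ 5 := by
  obtain ⟨h₁, h₂⟩ := dMin_spec hξ₁ n m
  have h₃ := h₂.trans (mu_anti (by linarith) _ (Nat.zero_le n))
  have : (m : ℝ) < 6 := by
    have key : ∀ d : ℕ, 1 ≤ d → d ≤ 3 → mu ξ d 0 < 6 := by
      intro d hd hd'
      interval_cases d <;> norm_num [mu] <;> linarith
    exact h₃.trans_lt (key _ h₁ h)
  have : m < 6 := by exact_mod_cast this
  omega

/-- Consequently an instance with `m ≤ 5` never undergoes an alternating split. -/
theorem five_le_mu {ξ : ℝ} (hξ : 1.9 ≤ ξ) {d : ℕ} (hd : 3 ≤ d) : 5 ≤ mu ξ d 0 := by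
  have h : 2 * d + 2 ≤ 2 ^ d := by
    induction d, hd using Nat.le_induction with
    | base => norm_num
    | succ d hd ih =>
      rw [pow_succ]
      omega
  have h' : (2 : ℝ) * d + 2 ≤ 2 ^ d := by exact_mod_cast h
  have hd' : (3 : ℝ) ≤ d := by exact_mod_cast hd
  have h₂ : (3 : ℝ) ≤ ξ * ((2 : ℝ) ^ d - (0 : ℕ) - 2) / d := by
    rw [le_div_iff₀ (by linarith)]
    push_cast
    nlinarith
  rw [mu]
  linarith

theorem le_flodd {x : ℝ} {y : ℤ} (hy : Odd y) (h : (y : ℝ) ≤ x) : y ≤ flodd x :=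
  (isGreatest_flodd x).2 ⟨hy, h⟩

theorem lt_flodd_add_two (x : ℝ) : x < flodd x + 2 := by
  by_contra! H
  have := le_flodd (x := x) (y := flodd x + 2)
    ((isGreatest_flodd x).1.1.add_even even_two) (by push_cast; exact H)
  omega

/-- If the prefix of an alternating split has length `2 j + 1`, then the remaining alternating
inputs fit into the parameter `e`. -/
theorem sub_le_mu {ξ : ℝ} (hξ₁ : 1 ≤ ξ) (hξ₂ : ξ < 2) {e n j : ℕ} {m : ℝ} (he : 3 ≤ e)
    (hn : n < 2 ^ e) (hm : m ≤ mu ξ (e + 1) n) (hk : mu ξ e n < (2 * j + 1) + 2) :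
    m - (2 * j + 1) ≤ mu ξ e j := by
  have hE : (3 : ℝ) ≤ e := by exact_mod_cast he
  have hP : (n : ℝ) + 1 ≤ 2 ^ e := by exact_mod_cast hn
  -- This is what the case `Q ≥ 0` below needs; it is an equality for `e = 3`. The next estimate
  -- `hP₂` serves the case `Q ≤ 0`, where `Q ≥ -1`.
  have hP₁ : 3 * (e : ℝ) ^ 2 + 3 * e ≤ 2 * (2 ^ e * (e - 1)) + 4 := by
    rcases eq_or_lt_of_le he with rfl | he'
    · norm_num
    · have := sq_le_two_pow e he'
      have h₁ : (e : ℝ) ^ 2 ≤ 2 ^ e := by exact_mod_cast this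
      have h₂ : (4 : ℝ) ≤ e := by exact_mod_cast he'
      have h₃ : (e : ℝ) ^ 2 * (e - 1) ≤ 2 ^ e * (e - 1) :=
        mul_le_mul_of_nonneg_right h₁ (by linarith)
      have h₄ : (4 * e) * ((e : ℝ) - 1) ≤ (e : ℝ) ^ 2 * (e - 1) :=
        mul_le_mul_of_nonneg_right (by nlinarith) (by linarith)
      nlinarith
  have hP₂ : 3 * (e : ℝ) + 5 ≤ 2 * 2 ^ e := by
    have : 3 * e + 5 ≤ 2 * 2 ^ e := by
      clear hk hm hn hP hP₁ hE
      induction e, he using Nat.le_induction with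
      | base => norm_num
      | succ d hd ih =>
        rw [pow_succ]
        omega
    exact_mod_cast this
  have hj : (0 : ℝ) ≤ j := Nat.cast_nonneg j
  have hn₀ : (0 : ℝ) ≤ n := Nat.cast_nonneg n
  unfold mu at *
  rw [pow_succ] at hm
  push_cast at hm
  set P : ℝ := 2 ^ e
  set E : ℝ := (e : ℝ)
  set k : ℝ := 2 * j + 1 with hkdef
  set Q : ℝ := P - n - 2 with hQ
  have hEpos : 0 < E := by linarith
  have hEk : ξ * Q / E ≤ k := by linarith
  -- After substituting `j = (k - 1) / 2`, the claim is monotone in `k` with slope `1 - ξ / (2 E) >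
  -- 0`, so `k` may be replaced by its lower bound `ξ Q / E`; `h₂` is the remaining inequality.
  have h₁ : ξ * Q / E * (E - ξ / 2) ≤ k * (E - ξ / 2) :=
    mul_le_mul_of_nonneg_right hEk (by linarith)
  have h₂ : (P + Q) * E ≤ (E + 1) * (P - 3 / 2 + Q - ξ / 2 * (Q / E)) := by
    set r := Q / E with hr
    have hQr : Q = r * E := by
      rw [hr]
      field_simp
    rcases le_total 0 r with hr₀ | hr₀
    · have h₃ : ξ / 2 * r ≤ r := by nlinarith
      have h₄ : r * E ≤ P - 2 := by linarith
      have h₅ : (E + 1) * (ξ / 2 * r) ≤ (E + 1) * r := by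
        exact mul_le_mul_of_nonneg_left h₃ (by linarith)
      have h₆ : E * (r + 3 / 2 * (E + 1)) ≤ E * P := by nlinarith
      have h₇ := le_of_mul_le_mul_left h₆ hEpos
      rw [hQr]
      nlinarith
    · have h₃ : ξ / 2 * r ≤ 0 := by nlinarith
      have h₅ : (E + 1) * (ξ / 2 * r) ≤ 0 := mul_nonpos_of_nonneg_of_nonpos (by linarith) h₃
      nlinarith
  have h₃ : ξ * (P + Q) / (E + 1) ≤ ξ * (P - j - 2) / E + k := by
    rw [div_add' _ _ _ hEpos.ne', div_le_div_iff₀ (by linarith) hEpos]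
    have h₄ : ξ * Q / E * (E - ξ / 2) = ξ * (Q - ξ / 2 * (Q / E)) := by
      field_simp
    have h₅ : ξ * (P - 3 / 2 + Q - ξ / 2 * (Q / E)) ≤ ξ * (P - j - 2) + k * E := by
      rw [h₄] at h₁
      have : (j : ℝ) = (k - 1) / 2 := by
        rw [hkdef]
        ring
      rw [this]
      nlinarith
    calc ξ * (P + Q) * E = ξ * ((P + Q) * E) := by ring
      _ ≤ ξ * ((E + 1) * (P - 3 / 2 + Q - ξ / 2 * (Q / E))) :=
        mul_le_mul_of_nonneg_left h₂ (by linarith)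
      _ = ξ * (P - 3 / 2 + Q - ξ / 2 * (Q / E)) * (E + 1) := by ring
      _ ≤ _ := mul_le_mul_of_nonneg_right h₅ (by linarith)
  have h₄ : P * 2 - n - 2 = P + Q := by
    rw [hQ]
    ring
  rw [h₄] at hm
  linarith

/-- The parameters of an alternating split with prefix of length `2 j + 1`. -/
theorem exists_flodd_mu_eq {ξ : ℝ} (hξ₁ : 1 ≤ ξ) (hξ₂ : ξ < 2) {n m e : ℕ} (he : 3 ≤ e)
    (hd : dMin ξ n m = e + 1) (hn : n < 2 ^ e) :
    ∃ j : ℕ, (flodd (mu ξ e n)).toNat = 2 * j + 1 ∧ ((2 * j + 1 : ℕ) : ℝ) ≤ mu ξ e n ∧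
      mu ξ e n < ((2 * j + 1 : ℕ) : ℝ) + 2 ∧ 2 * j + 1 < m ∧ dMin ξ n (2 * j + 1) ≤ e ∧
      dMin ξ j (m - (2 * j + 1)) ≤ e := by
  have hE : (3 : ℝ) ≤ e := by exact_mod_cast he
  have hP : (n : ℝ) + 1 ≤ 2 ^ e := by exact_mod_cast hn
  -- As no symmetric split applies, `2 ^ e - n - 2 ≥ -1`; hence the prefix is nonempty.
  have hmu : ((1 : ℤ) : ℝ) ≤ mu ξ e n := by
    have : -1 ≤ ξ * ((2 : ℝ) ^ e - n - 2) / e := by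
      rw [le_div_iff₀ (by linarith)]
      nlinarith
    rw [mu]
    push_cast
    linarith
  have h₁ := le_flodd odd_one hmu
  obtain ⟨⟨i, hi⟩, hle⟩ := (isGreatest_flodd (mu ξ e n)).1
  have hlt := lt_flodd_add_two (mu ξ e n)
  rw [hi] at hle hlt h₁
  lift i to ℕ using by omega with j
  push_cast at hle hlt
  have hm := (dMin_spec hξ₁ n m).2
  have hkm : mu ξ e n < m := mu_lt_of_lt_dMin (by omega) (by omega)
  have hjm : 2 * j + 1 < m := by
    have : (2 * j + 1 : ℝ) < m := by linarith
    exact_mod_cast this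
  refine ⟨j, by omega, by push_cast; exact hle, by push_cast; exact hlt, hjm,
    dMin_le (by omega) (by push_cast; exact hle), dMin_le (by omega) ?_⟩
  rw [hd] at hm
  rw [Nat.cast_sub hjm.le]
  push_cast
  exact sub_le_mu hξ₁ hξ₂ he hn hm hlt

theorem rho_nonneg (N : ℕ) : 0 ≤ rho N := by
  simpa using le_rho (b := 0) (N := N) (Nat.pow_le_pow_left (Nat.le_add_left 2 N) 2)

theorem psi_nonneg {ξ : ℝ} (hξ : 0 ≤ ξ) {d : ℕ} (hd : 2 ≤ d) : 0 ≤ psi ξ d := by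
  have hd' : (2 : ℝ) ≤ d := by exact_mod_cast hd
  have h2 : (2 : ℝ) ^ 1 ≤ 2 ^ (d - 1) := pow_le_pow_right₀ one_le_two (by omega)
  have hx : 0 ≤ ξ * ((2 : ℝ) ^ (d - 1) - 2) / ((d : ℝ) - 1) :=
    div_nonneg (mul_nonneg hξ (by linarith)) (by linarith)
  refine div_nonneg (add_nonneg zero_le_one (rho_nonneg _)) ?_
  have : (0 : ℝ) ≤ ⌈ξ * ((2 : ℝ) ^ (d - 1) - 2) / ((d : ℝ) - 1)⌉ := hx.trans (Int.le_ceil _)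
  linarith

/-- The additional term of an alternating split is paid for by `ψ`. -/
theorem one_add_le_mul_psi {ξ : ℝ} (hξ : 0 ≤ ξ) {e j b m : ℕ} (he : 1 ≤ e)
    (hm : mu ξ e 0 < m) (hk : ((2 * j + 1 : ℕ) : ℝ) ≤ mu ξ e 0)
    (hb : 2 ^ (b + 2) ≤ (j + 2) ^ 2) : 1 + (b : ℝ) ≤ psi ξ (e + 1) * m := by
  have hE : (1 : ℝ) ≤ e := by exact_mod_cast he
  have h2 : (2 : ℝ) ^ 1 ≤ 2 ^ e := pow_le_pow_right₀ one_le_two he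
  have hx₀ : 0 ≤ ξ * ((2 : ℝ) ^ e - 2) / e :=
    div_nonneg (mul_nonneg hξ (by linarith)) (by linarith)
  unfold mu at hm hk
  unfold psi
  push_cast at hm hk ⊢
  simp only [add_sub_cancel_right]
  rw [sub_zero] at hm hk
  set x := ξ * ((2 : ℝ) ^ e - 2) / e
  have hceil : (⌈x⌉ : ℝ) + 2 ≤ m := by
    have : ⌈x⌉ ≤ (m : ℤ) - 2 := Int.ceil_le.2 (by push_cast; linarith)
    have : ((⌈x⌉ : ℤ) : ℝ) ≤ (((m : ℤ) - 2 : ℤ) : ℝ) := Int.cast_le.2 this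
    push_cast at this
    linarith
  have hceil₀ : (0 : ℝ) ≤ ⌈x⌉ := hx₀.trans (Int.le_ceil _)
  have hj : j ≤ ((flodd x + 1) / 2).toNat := by
    have : 2 * (j : ℤ) - 1 ≤ flodd x :=
      le_flodd ⟨(j : ℤ) - 1, by ring⟩ (by push_cast; linarith)
    omega
  -- The hypothesis on `b` is monotone in the interval length, so monotonicity of `rho` is not
  -- needed.
  have hρ : (b : ℝ) ≤ rho ((flodd x + 1) / 2).toNat :=
    le_rho (hb.trans (Nat.pow_le_pow_left (by omega) 2))
  have hb₀ : (0 : ℝ) ≤ b := Nat.cast_nonneg b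
  rw [div_mul_eq_mul_div, le_div_iff₀ (by linarith)]
  exact mul_le_mul (by linarith) hceil (by linarith) (by linarith)

theorem phi_of_le_four (ξ : ℝ) {d : ℕ} (hd : d ≤ 4) : phi ξ d = -1.67 := by
  cases d with
  | zero => rfl
  | succ d => rw [phi, if_pos hd]

theorem phi_succ (ξ : ℝ) {d : ℕ} (hd : 4 ≤ d) : phi ξ (d + 1) = phi ξ d + psi ξ (d + 1) := by
  rw [phi, if_neg (by omega)]

theorem phi_mono {ξ : ℝ} (hξ : 0 ≤ ξ) : Monotone (phi ξ) := by
  refine monotone_nat_of_le_succ fun d => ?_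
  rcases le_or_gt d 3 with h | h
  · rw [phi_of_le_four ξ (by omega), phi_of_le_four ξ (by omega)]
  · rw [phi_succ ξ h]
    exact le_add_of_nonneg_right (psi_nonneg hξ (by omega))

/-- Since `8.65 ≤ μ(4, 0) < 9`, an alternating split with `m = 9`, `j = 3` and `b = 2` is
admissible, which gives `3 ≤ 9 ψ(5)`. -/
theorem one_third_le_psi_five {ξ : ℝ} (hξ₁ : 1.9 ≤ ξ) (hξ₂ : ξ < 2) : 1 / 3 ≤ psi ξ 5 := by
  norm_num at hξ₁
  have h := one_add_le_mul_psi (ξ := ξ) (e := 4) (j := 3) (b := 2) (m := 9) (by linarith)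
    (by norm_num) (by rw [mu_four]; push_cast; linarith) (by rw [mu_four]; push_cast; linarith)
    (by norm_num)
  push_cast at h
  linarith

/-! ### Entries at odd and even positions -/

theorem evenEntries_cons_and_oddEntries_cons (l : List ℕ) : ∀ x : ℕ,
    evenEntries (x :: l) = x :: oddEntries l ∧ oddEntries (x :: l) = evenEntries l := by
  induction l with
  | nil => exact fun _ => ⟨rfl, rfl⟩
  | cons y l ih =>
    intro x
    rw [(ih y).1, (ih y).2, evenEntries, oddEntries]
    exact ⟨rfl, rfl⟩

@[simp] theorem evenEntries_cons (x : ℕ) (l : List ℕ) :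
    evenEntries (x :: l) = x :: oddEntries l :=
  (evenEntries_cons_and_oddEntries_cons l x).1

@[simp] theorem oddEntries_cons (x : ℕ) (l : List ℕ) : oddEntries (x :: l) = evenEntries l :=
  (evenEntries_cons_and_oddEntries_cons l x).2

@[simp] theorem evenEntries_nil : evenEntries [] = [] := rfl

@[simp] theorem oddEntries_nil : oddEntries [] = [] := rfl

theorem evenEntries_and_oddEntries_take (t : List ℕ) (k : ℕ) :
    evenEntries (t.take k) <+: evenEntries t ∧ oddEntries (t.take k) <+: oddEntries t := by
  induction t generalizing k with
  | nil => simp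
  | cons x t ih =>
    cases k with
    | zero => simp
    | succ k => simpa using (ih k).symm

/-- Dropping an odd number of entries exchanges the two parities, in step with the passage to the
dual function. -/
theorem evenEntries_and_oddEntries_drop (j : ℕ) (t : List ℕ) :
    evenEntries (t.drop (2 * j + 1)) <:+ oddEntries t ∧
      oddEntries (t.drop (2 * j + 1)) <:+ evenEntries t := by
  induction j generalizing t with
  | zero =>
    cases t with
    | nil => simp
    | cons x t => simp
  | succ j ih =>
    match t with
    | [] => simp
    | [x] => simp
    | x :: y :: t =>
      have h := ih t
      simp only [evenEntries_cons, oddEntries_cons, Nat.mul_succ, List.drop_succ_cons]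
      exact ⟨h.1.trans (List.suffix_cons _ _), h.2.trans (List.suffix_cons _ _)⟩

theorem length_oddEntries_take {j : ℕ} {t : List ℕ} (h : 2 * j + 1 ≤ t.length) :
    (oddEntries (t.take (2 * j + 1))).length = j := by
  induction j generalizing t with
  | zero =>
    cases t with
    | nil => simp
    | cons x t => simp
  | succ j ih =>
    match t with
    | [] => simp at h
    | [x] => simp at h
    | x :: y :: t =>
      simp only [List.length_cons] at h
      simpa [Nat.mul_succ] using ih (t := t) (by omega)

/-! ### Inputs of the recursive calls -/

@[simp] theorem Op.dual_dual (op : Op) : op.dual.dual = op := by cases op <;> rfl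

/-- A pair of leftist circuits on distinct inputs. -/
structure IsLeftistPair (S : Op → List Tree) : Prop where
  forest : ∀ op, IsLeftistForest (S op)
  nodup : ∀ op, (leaves (S op)).Nodup

/-- The list `s` consists of distinct inputs of the leftist `op`-circuit. -/
structure IsSymmetricInput (S : Op → List Tree) (op : Op) (s : List ℕ) : Prop where
  nodup : s.Nodup
  subset : s ⊆ leaves (S op)

/-- The entries of `t` are alternatingly consecutive inputs of the leftist `op`-circuit and of the
leftist circuit for the dual operation. -/
structure IsAlternatingInput (S : Op → List Tree) (op : Op) (t : List ℕ) : Prop where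
  even : evenEntries t <:+: leaves (S op)
  odd : oddEntries t <:+: leaves (S op.dual)

/-- The number of boundary trees of `K`. -/
def boundaryCount (S : Op → List Tree) (op : Op) (K : List ℕ) : ℕ :=
  (boundaryTrees K (S op)).length

variable {S : Op → List Tree} {op : Op} {s t : List ℕ}

theorem IsAlternatingInput.take (h : IsAlternatingInput S op t) (k : ℕ) :
    IsAlternatingInput S op (t.take k) :=
  ⟨(evenEntries_and_oddEntries_take t k).1.isInfix.trans h.even,
    (evenEntries_and_oddEntries_take t k).2.isInfix.trans h.odd⟩

theorem IsAlternatingInput.drop (h : IsAlternatingInput S op t) (j : ℕ) :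
    IsAlternatingInput S op.dual (t.drop (2 * j + 1)) :=
  ⟨(evenEntries_and_oddEntries_drop j t).1.isInfix.trans h.odd, by
    rw [Op.dual_dual]
    exact (evenEntries_and_oddEntries_drop j t).2.isInfix.trans h.even⟩

theorem IsSymmetricInput.of_infix (hS : IsLeftistPair S) (h : s <:+: leaves (S op)) :
    IsSymmetricInput S op s :=
  ⟨(hS.nodup op).sublist h.sublist, h.subset⟩

theorem IsSymmetricInput.filter (h : IsSymmetricInput S op s) (p : ℕ → Bool) :
    IsSymmetricInput S op (s.filter p) :=
  ⟨h.nodup.filter p, fun _ hx => h.subset (List.mem_of_mem_filter hx)⟩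

theorem IsSymmetricInput.nil : IsSymmetricInput S op [] := ⟨List.nodup_nil, List.nil_subset _⟩

theorem boundaryCount_nil : boundaryCount S op [] = 0 := by
  rw [boundaryCount, boundaryTrees_eq_nil (by simp)]
  rfl

theorem boundaryCount_append_singleton_le (hS : IsLeftistPair S) (K : List ℕ) (v : ℕ) :
    boundaryCount S op (K ++ [v]) ≤ boundaryCount S op K + 1 :=
  length_boundaryTrees_append_singleton_le (hS.nodup op) K v

theorem one_le_boundaryCount {K : List ℕ} {x : ℕ} (hx : x ∈ K) (hx' : x ∈ leaves (S op)) :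
    1 ≤ boundaryCount S op K := by
  have h : x ∈ leaves (boundaryTrees K (S op)) := by
    rw [leaves_boundaryTrees]
    simpa using ⟨hx', hx⟩
  obtain ⟨T, hT, -⟩ := List.mem_flatMap.1 h
  exact List.length_pos_of_mem hT

theorem two_pow_boundaryCount_le (hS : IsLeftistPair S) {I : List ℕ}
    (hI : I <:+: leaves (S op)) : 2 ^ (boundaryCount S op I + 2) ≤ (I.length + 2) ^ 2 :=
  two_pow_length_boundaryTrees_le_of_infix (hS.forest op) (hS.nodup op) hI

theorem boundaryCount_le (hS : IsLeftistPair S) {I : List ℕ} (hI : I <:+: leaves (S op)) {c : ℕ}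
    (hc : (I.length + 2) ^ 2 < 2 ^ (c + 3)) : boundaryCount S op I ≤ c := by
  have h := (two_pow_boundaryCount_le hS hI).trans_lt hc
  have := (Nat.pow_lt_pow_iff_right one_lt_two).1 h
  omega

/-! ### Base cases -/

/-- The count keeps `s ++ [t₀]` together: in a critical case `t₀` merges with `s`, and estimating by
`boundaryCount S op s + 1` would lose a gate. -/
theorem addsAtMost_baseCircuit {t₀ : ℕ} (ht₀ : t₀ ∈ leaves (S op)) {l : List ℕ}
    (hl : l.length ≤ 3) :
    AddsAtMost (baseCircuit S op s (t₀ :: l))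
      (boundaryCount S op (s ++ [t₀]) + l.length - 1) := by
  have hb : 1 ≤ boundaryCount S op (s ++ [t₀]) := one_le_boundaryCount (by simp) ht₀
  have key : ∀ (L : List (ℕ × ℕ)) (c : ℕ), L.length = c →
      AddsAtMost (symTree .baseCase S op (s ++ [t₀]) L)
        (boundaryCount S op (s ++ [t₀]) + c - 1) := fun L c hc => by
    subst hc
    refine (addsAtMost_symTree _ _ _ _ _).mono (le_of_eq ?_)
    change ((boundaryCount S op (s ++ [t₀]) + L.length - 1 : ℕ) : ℝ) = _
    rw [Nat.cast_sub (by omega)]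
    push_cast
    ring
  match l, hl with
  | [], _ => exact key [] 0 rfl
  | [t₁], _ => exact key _ 1 rfl
  | [t₁, t₂], _ =>
    refine ((addsAtMost_addGate _ _ _ _).bind fun u => key [(u, 1)] 1 rfl).mono (le_of_eq ?_)
    simp
    ring
  | [t₁, t₂, t₃], _ =>
    refine ((addsAtMost_addGate _ _ _ _).bind fun u =>
      (addsAtMost_addGate _ _ _ _).bind fun v => key [(v, 2)] 1 rfl).mono (le_of_eq ?_)
    simp
    ring

theorem addsAtMost_baseCircuit_five (t₀ t₁ t₂ t₃ t₄ : ℕ) :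
    AddsAtMost (baseCircuit S op s [t₀, t₁, t₂, t₃, t₄])
      (boundaryCount S op (s ++ [t₀]) + boundaryCount S op.dual [t₁, t₃] + 2) := by
  have key : ∀ u v : ℕ, AddsAtMost (symTree .baseCase S op (s ++ [t₀]) [(u, 1), (v, 2)])
      ((boundaryCount S op (s ++ [t₀]) + 1 : ℕ) : ℝ) := fun u v => addsAtMost_symTree _ _ _ _ _
  have key' : AddsAtMost (symTree .baseCase S op.dual [t₁, t₃] [(t₄, 0)])
      (boundaryCount S op.dual [t₁, t₃] : ℝ) := addsAtMost_symTree _ _ _ _ _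
  refine ((addsAtMost_addGate _ _ _ _).bind fun u => key'.bind fun v =>
    key u v).mono (le_of_eq ?_)
  push_cast
  ring

/-- The bound for at most five alternating inputs. -/
def fewAlternatingBound (S : Op → List Tree) (op : Op) (t : List ℕ) : ℝ :=
  if t.length ≤ 4 then (t.length : ℝ) - 1 else boundaryCount S op.dual (oddEntries t) + 3

theorem fewAlternatingBound_nonneg (ht : 1 ≤ t.length) : 0 ≤ fewAlternatingBound S op t := by
  have : (1 : ℝ) ≤ t.length := by exact_mod_cast ht
  rw [fewAlternatingBound]
  split_ifs
  · linarith
  · positivity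

theorem addsAtMost_baseCircuit_of_length_le_five (hS : IsLeftistPair S)
    (ht : IsAlternatingInput S op t) (h₁ : 1 ≤ t.length) (h₅ : t.length ≤ 5) :
    AddsAtMost (baseCircuit S op s t) (boundaryCount S op s + fewAlternatingBound S op t) := by
  cases t with
  | nil => simp at h₁
  | cons t₀ l =>
    have hle : ((boundaryCount S op (s ++ [t₀]) : ℕ) : ℝ) ≤ boundaryCount S op s + 1 := by
      exact_mod_cast boundaryCount_append_singleton_le hS s t₀
    have ht₀ : t₀ ∈ leaves (S op) := ht.even.subset (by simp)
    rw [fewAlternatingBound]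
    split_ifs with h
    · refine (addsAtMost_baseCircuit ht₀ (by simp at h; omega)).mono ?_
      simp only [List.length_cons]
      push_cast
      linarith
    · have hl : l.length = 4 := by
        simp only [List.length_cons] at h h₅
        omega
      clear ht
      match l, hl with
      | [t₁, t₂, t₃, t₄], _ =>
        refine (addsAtMost_baseCircuit_five t₀ t₁ t₂ t₃ t₄).mono ?_
        simp only [evenEntries_cons, oddEntries_cons, evenEntries_nil]
        linarith

/-! ### One step of the recursion -/

variable {ξ : ℝ}

/-- Running out of fuel adds no gates, so the upper bounds hold for every amount of fuel. -/
theorem addsAtMost_aop_zero {c : ℝ} (hc : 0 ≤ c) : AddsAtMost (aop ξ S 0 op s t) c :=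
  AddsAtMost.pure _ hc

/-- It suffices to bound the base cases and the alternating splits, since symmetric and simple
splits cost as many gates as they remove boundary trees. -/
theorem addsAtMost_aop_succ (hξ₁ : 1.9 ≤ ξ) (hξ₂ : ξ < 2) (hS : IsLeftistPair S)
    (hs : IsSymmetricInput S op s) {fuel : ℕ} {g : ℝ}
    (hbase : t.length ≤ 2 ∨ dMin ξ s.length t.length ≤ 3 →
      AddsAtMost (baseCircuit S op s t) (boundaryCount S op s + g))
    (hsplit : ∀ s', 4 ≤ dMin ξ s.length t.length →
      (2 ^ (dMin ξ s.length t.length - 1) ≤ s.length ∨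
        (t.length : ℝ) ≤ mu ξ (dMin ξ s.length t.length - 1) 0) →
      IsSymmetricInput S op s' → s'.length ≤ s.length →
      AddsAtMost (aop ξ S fuel op s' t) (boundaryCount S op s' + g))
    (halt : ∀ e j : ℕ, dMin ξ s.length t.length = e + 1 → 3 ≤ e →
      mu ξ e 0 < t.length → ((2 * j + 1 : ℕ) : ℝ) ≤ mu ξ e s.length →
      mu ξ e s.length < ((2 * j + 1 : ℕ) : ℝ) + 2 → 2 * j + 1 < t.length →
      dMin ξ s.length (2 * j + 1) ≤ e → dMin ξ j (t.length - (2 * j + 1)) ≤ e →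
      ∃ c₁ c₂, AddsAtMost (aop ξ S fuel op s (t.take (2 * j + 1))) c₁ ∧
        AddsAtMost (aop ξ S fuel op.dual (oddEntries (t.take (2 * j + 1)))
          (t.drop (2 * j + 1))) c₂ ∧ c₁ + (c₂ + 1) ≤ boundaryCount S op s + g) :
    AddsAtMost (aop ξ S (fuel + 1) op s t) (boundaryCount S op s + g) := by
  norm_num at hξ₁
  have hξ : 1 ≤ ξ := by linarith
  rw [aop]
  dsimp only
  split_ifs with h₁ h₂ h₃
  · exact hbase h₁
  · push Not at h₁
    obtain ⟨Us, hne, hUs, heq⟩ := exists_triangularSubset_eq_leaves (hS.forest op).isFull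
      (hS.nodup op) hs.nodup hs.subset
      (List.length_pos_iff.1 (lt_of_lt_of_le (by positivity) h₂))
    obtain ⟨hone, hle⟩ := boundaryTrees_split (hS.nodup op) hne hUs
    rw [heq]
    refine ((addsAtMost_symTree _ _ _ _ _).bind fun a =>
      (hsplit _ (by omega) (.inl h₂) (hs.filter _) (List.length_filter_le _ _)).bind fun b =>
        addsAtMost_addGate _ _ _ _).mono ?_
    simp only [List.length_nil, Nat.add_zero]
    rw [Nat.cast_sub hone]
    have : (((boundaryTrees (leaves Us) (S op)).length : ℕ) : ℝ) +
        boundaryCount S op (s.filter fun x => x ∉ leaves Us) ≤ boundaryCount S op s := by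
      exact_mod_cast hle
    push_cast
    linarith
  · push Not at h₁
    -- For empty `s` the condition of a simple split contradicts minimality of `d`. Thus `b(s) ≥ 1`,
    -- and the truncated subtraction `b(s) - 1` is exact.
    have hpos : s ≠ [] := by
      rintro rfl
      have := mu_lt_of_lt_dMin (ξ := ξ) (n := 0) (m := t.length)
        (d := dMin ξ 0 t.length - 1) (by simp at h₁; omega) (by simp at h₁; omega)
      exact absurd h₃ (not_le.2 (by simpa using this))
    obtain ⟨x, hx⟩ := List.exists_mem_of_ne_nil _ hpos
    have hone := one_le_boundaryCount hx (hs.subset hx)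
    refine ((addsAtMost_symTree _ _ _ _ _).bind fun a =>
      (hsplit _ (by omega) (.inr h₃) IsSymmetricInput.nil (by simp)).bind fun b =>
        addsAtMost_addGate _ _ _ _).mono ?_
    change ((boundaryCount S op s - 1 : ℕ) : ℝ) + _ ≤ _
    rw [Nat.cast_sub hone, boundaryCount_nil]
    push_cast
    linarith
  · push Not at h₁ h₂ h₃
    obtain ⟨e, he⟩ : ∃ e, dMin ξ s.length t.length = e + 1 :=
      ⟨dMin ξ s.length t.length - 1, by omega⟩
    rw [he, Nat.add_sub_cancel] at h₂ h₃ ⊢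
    obtain ⟨j, hj, a₁, a₂, a₃, a₄, a₅⟩ := exists_flodd_mu_eq hξ hξ₂ (by omega) he h₂
    rw [hj]
    obtain ⟨c₁, c₂, b₁, b₂, b₃⟩ := halt e j he (by omega) h₃ a₁ a₂ a₃ a₄ a₅
    exact (b₁.bind fun a => b₂.bind fun b => addsAtMost_addGate _ _ _ _).mono b₃

/-! ### Small parameters -/

theorem addsAtMost_aop_of_length_le_five (hξ₁ : 1.9 ≤ ξ) (hξ₂ : ξ < 2) (hS : IsLeftistPair S)
    (hs : IsSymmetricInput S op s) (ht : IsAlternatingInput S op t) (h₁ : 1 ≤ t.length)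
    (h₅ : t.length ≤ 5) (fuel : ℕ) :
    AddsAtMost (aop ξ S fuel op s t) (boundaryCount S op s + fewAlternatingBound S op t) := by
  induction fuel generalizing s with
  | zero =>
    exact addsAtMost_aop_zero (add_nonneg (Nat.cast_nonneg _) (fewAlternatingBound_nonneg h₁))
  | succ fuel ih =>
    refine addsAtMost_aop_succ hξ₁ hξ₂ hS hs
      (fun _ => addsAtMost_baseCircuit_of_length_le_five hS ht h₁ h₅)
      (fun s' _ _ hs' _ => ih hs') fun e j _ he hlt => ?_
    have : (t.length : ℝ) ≤ 5 := by exact_mod_cast h₅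
    linarith [five_le_mu hξ₁ he]

theorem addsAtMost_aop_of_isBase {t₀ : ℕ} (ht₀ : t₀ ∈ leaves (S op)) {l : List ℕ}
    (hl : l.length ≤ 3) (hd : dMin ξ s.length (l.length + 1) ≤ 3) (fuel : ℕ) :
    AddsAtMost (aop ξ S fuel op s (t₀ :: l))
      (boundaryCount S op (s ++ [t₀]) + l.length - 1) := by
  cases fuel with
  | zero =>
    have : (1 : ℝ) ≤ boundaryCount S op (s ++ [t₀]) := by
      exact_mod_cast one_le_boundaryCount (by simp) ht₀
    exact addsAtMost_aop_zero (by linarith [Nat.cast_nonneg (α := ℝ) l.length])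
  | succ fuel =>
    rw [aop]
    dsimp only
    rw [if_pos (.inr (by simpa using hd))]
    exact addsAtMost_baseCircuit ht₀ hl

theorem fewAlternatingBound_of_le_four (h : t.length ≤ 4) :
    fewAlternatingBound S op t = t.length - 1 := if_pos h

theorem fewAlternatingBound_le (hS : IsLeftistPair S) (ht : IsAlternatingInput S op t)
    (h₅ : t.length ≤ 5) : fewAlternatingBound S op t ≤ t.length := by
  rw [fewAlternatingBound]
  split_ifs with h
  · linarith
  · have ht5 : t.length = 5 := by omega
    have hlen : (oddEntries t).length = 2 := by
      simpa [List.take_of_length_le h₅] using length_oddEntries_take (j := 2) (t := t) (by omega)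
    have : ((boundaryCount S op.dual (oddEntries t) : ℕ) : ℝ) ≤ 2 := by
      exact_mod_cast boundaryCount_le hS ht.odd (by rw [hlen]; norm_num)
    rw [ht5]
    push_cast
    linarith

/-- The bound in case that the parameter is at most four. For at most one symmetric input it depends
on whether the first two inputs of the dual leftist circuit occurring in `t` form a full tree. -/
theorem addsAtMost_aop_of_dMin_le_four (hξ₁ : 1.9 ≤ ξ) (hξ₂ : ξ < 2) (hS : IsLeftistPair S)
    (hs : IsSymmetricInput S op s) (ht : IsAlternatingInput S op t) (h₆ : 6 ≤ t.length)
    (hd : dMin ξ s.length t.length ≤ 4) (fuel : ℕ) :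
    AddsAtMost (aop ξ S fuel op s t) (boundaryCount S op s +
      if s.length ≤ 1 then (t.length : ℝ) - 1 + boundaryCount S op.dual (oddEntries (t.take 5))
      else t.length) := by
  have h₆' : (6 : ℝ) ≤ t.length := by exact_mod_cast h₆
  cases fuel with
  | zero =>
    refine addsAtMost_aop_zero (add_nonneg (Nat.cast_nonneg _) ?_)
    split_ifs
    · exact add_nonneg (by linarith) (Nat.cast_nonneg _)
    · linarith
  | succ fuel =>
    have hξ₁' := hξ₁
    norm_num at hξ₁'
    have hξ : 1 ≤ ξ := by linarith
    have hd4 : dMin ξ s.length t.length = 4 := by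
      by_contra H
      have := le_five_of_dMin_le_three hξ hξ₂ (show dMin ξ s.length t.length ≤ 3 by omega)
      omega
    have hm := (dMin_spec hξ s.length t.length).2
    rw [hd4, mu_four] at hm
    have hn₀ : (0 : ℝ) ≤ s.length := Nat.cast_nonneg _
    refine addsAtMost_aop_succ hξ₁ hξ₂ hS hs ?_ ?_ ?_
    · intro H
      omega
    -- Only alternating splits remain: `n ≥ 8` would force `m < 5`, and `μ(3, 0) < 6`.
    · intro s' _ H
      rw [hd4] at H
      rcases H with H | H
      · have : (8 : ℝ) ≤ s.length := by exact_mod_cast H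
        nlinarith
      · rw [mu_three] at H
        push_cast at H
        linarith
    · intro e j he _ hlt hj₁ hj₂ hjm hd₁ hd₂
      obtain rfl : e = 3 := by omega
      rw [mu_three] at hlt hj₁ hj₂
      push_cast at hlt hj₁ hj₂
      have hlen : (t.take (2 * j + 1)).length = 2 * j + 1 := by simp; omega
      have hsym : IsSymmetricInput S op.dual (oddEntries (t.take (2 * j + 1))) :=
        .of_infix hS (ht.take _).odd
      have hodd := length_oddEntries_take hjm.le
      have hj : j < 3 := by
        have : (j : ℝ) < 3 := by nlinarith
        exact_mod_cast this
      have hfirst := addsAtMost_aop_of_length_le_five hξ₁ hξ₂ hS hs (ht.take (2 * j + 1))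
        (by omega) (by omega) fuel
      interval_cases j
      · have hn : 2 ≤ s.length := by
          by_contra! H
          have : (s.length : ℝ) ≤ 1 := by exact_mod_cast Nat.lt_succ_iff.1 H
          push_cast at hj₂
          nlinarith
        have hm₅ := le_five_of_dMin_le_three hξ hξ₂ hd₂
        refine ⟨_, _, hfirst, addsAtMost_aop_of_length_le_five hξ₁ hξ₂ hS hsym (ht.drop 0)
          (by simp; omega) (by simpa using hm₅) fuel, ?_⟩
        have hb := fewAlternatingBound_le hS (ht.drop 0) (by simpa using hm₅)
        have hnil : oddEntries (t.take (2 * 0 + 1)) = [] := List.length_eq_zero_iff.1 hodd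
        rw [hnil, boundaryCount_nil, fewAlternatingBound_of_le_four (by omega), hlen,
          if_neg (by omega)]
        rw [List.length_drop, Nat.cast_sub (by omega)] at hb
        push_cast at hb ⊢
        linarith
      · have hn : 2 ≤ s.length := by
          by_contra! H
          have : (s.length : ℝ) ≤ 1 := by exact_mod_cast Nat.lt_succ_iff.1 H
          push_cast at hj₂
          nlinarith
        have hm₇ : t.length < 8 := by
          have : (2 : ℝ) ≤ s.length := by exact_mod_cast hn
          have : (t.length : ℝ) < 8 := by nlinarith
          exact_mod_cast this
        refine ⟨_, _, hfirst, addsAtMost_aop_of_length_le_five hξ₁ hξ₂ hS hsym (ht.drop 1)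
          (by simp; omega) (by simp; omega) fuel, ?_⟩
        have hb : ((boundaryCount S op.dual (oddEntries (t.take (2 * 1 + 1))) : ℕ) : ℝ) ≤ 1 := by
          exact_mod_cast boundaryCount_le hS (ht.take _).odd (by rw [hodd]; norm_num)
        rw [fewAlternatingBound_of_le_four (by omega), hlen,
          fewAlternatingBound_of_le_four (by simp; omega), if_neg (by omega), List.length_drop,
          Nat.cast_sub (by omega)]
        push_cast
        linarith
      · have hn : s.length ≤ 1 := by
          by_contra! H
          have : (2 : ℝ) ≤ s.length := by exact_mod_cast H
          push_cast at hj₁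
          nlinarith
        have hm₈ : t.length < 9 := by
          have : (t.length : ℝ) < 9 := by nlinarith
          exact_mod_cast this
        match t, h₆ with
        | t₀ :: t₁ :: t₂ :: t₃ :: t₄ :: t₅ :: l, _ =>
          have hinf : [t₁, t₃, t₅] <:+: leaves (S op.dual) :=
            List.IsInfix.trans ⟨[], oddEntries l, by simp⟩
              (by simpa using ht.odd : t₁ :: t₃ :: t₅ :: oddEntries l <:+: leaves (S op.dual))
          -- Three consecutive leaves have at most two boundary trees. This is where keeping `t₅`
          -- together with `t₁, t₃` saves a gate.
          have hb : ((boundaryCount S op.dual [t₁, t₃, t₅] : ℕ) : ℝ) ≤ 2 := by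
            exact_mod_cast boundaryCount_le hS hinf (by norm_num)
          have hll : l.length ≤ 2 := by simp at hm₈; omega
          refine ⟨_, _, hfirst, addsAtMost_aop_of_isBase (t₀ := t₅) (l := l)
            (hinf.subset (by simp)) (by omega) (by simpa using hd₂) fuel, ?_⟩
          rw [if_pos hn, fewAlternatingBound, if_neg (by omega)]
          simp only [List.take_succ_cons, List.take_zero, evenEntries_cons, oddEntries_cons,
            evenEntries_nil, List.cons_append, List.nil_append, List.length_cons]
          push_cast
          linarith

/-- The final term records the surplus over `b(s) + m`. The gate saved for `m ≤ 4` is needed to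
offset losses when two such bounds are combined for `d = 5`. -/
theorem addsAtMost_aop_small (hξ₁ : 1.9 ≤ ξ) (hξ₂ : ξ < 2) (hS : IsLeftistPair S)
    (hs : IsSymmetricInput S op s) (ht : IsAlternatingInput S op t) (h₁ : 1 ≤ t.length)
    (hd : dMin ξ s.length t.length ≤ 4) (fuel : ℕ) :
    AddsAtMost (aop ξ S fuel op s t) (boundaryCount S op s + t.length +
      if t.length ≤ 4 then -1 else if t.length ≤ 5 ∨ 2 ≤ s.length then 0 else 1) := by
  rcases le_or_gt t.length 5 with h₅ | h₆
  · refine (addsAtMost_aop_of_length_le_five hξ₁ hξ₂ hS hs ht h₁ h₅ fuel).mono ?_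
    split_ifs with h
    · rw [fewAlternatingBound_of_le_four h]
      linarith
    · linarith [fewAlternatingBound_le hS ht h₅]
    · omega
  · refine (addsAtMost_aop_of_dMin_le_four hξ₁ hξ₂ hS hs ht h₆ hd fuel).mono ?_
    have hlen := length_oddEntries_take (j := 2) (t := t) (by omega)
    have hb : ((boundaryCount S op.dual (oddEntries (t.take 5)) : ℕ) : ℝ) ≤ 2 := by
      exact_mod_cast boundaryCount_le hS (ht.take _).odd (by rw [hlen]; norm_num)
    split_ifs <;> first | omega | linarith

/-! ### The general bound -/

/-- The parameter is only required to be at most `D`, so that the hypothesis for `D = e` applies to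
both parts of a split. From `D = 5` on the factor is at least `4 / 3`, which covers the surplus gate
of instances with parameter at most four, as these have `m ≥ 6`. -/
theorem addsAtMost_aop_of_five_le (hξ₁ : 1.9 ≤ ξ) (hξ₂ : ξ < 2) (hS : IsLeftistPair S)
    (hs : IsSymmetricInput S op s) (ht : IsAlternatingInput S op t) (h₁ : 1 ≤ t.length) {D : ℕ}
    (hD : 5 ≤ D) (hd : dMin ξ s.length t.length ≤ D) (fuel : ℕ) :
    AddsAtMost (aop ξ S fuel op s t) (boundaryCount S op s + (2.67 + phi ξ D) * t.length) := by
  have hξ₁' := hξ₁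
  norm_num at hξ₁'
  have hξ : 1 ≤ ξ := by linarith
  induction fuel generalizing op s t D with
  | zero =>
    refine addsAtMost_aop_zero (add_nonneg (Nat.cast_nonneg _) (mul_nonneg ?_ (Nat.cast_nonneg _)))
    have := phi_mono (ξ := ξ) (by linarith) (Nat.zero_le D)
    rw [phi_of_le_four ξ (Nat.zero_le 4)] at this
    linarith
  | succ fuel ih =>
    have hφ : 4 / 3 ≤ 2.67 + phi ξ D := by
      have h := phi_mono (ξ := ξ) (by linarith) hD
      rw [phi_succ ξ le_rfl, phi_of_le_four ξ le_rfl] at h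
      linarith [one_third_le_psi_five hξ₁ hξ₂]
    have hm₀ : (1 : ℝ) ≤ t.length := by exact_mod_cast h₁
    have hg : 4 / 3 * (t.length : ℝ) ≤ (2.67 + phi ξ D) * t.length :=
      mul_le_mul_of_nonneg_right hφ (by linarith)
    rcases le_or_gt (dMin ξ s.length t.length) 4 with hd₄ | hd₅
    · refine (addsAtMost_aop_small hξ₁ hξ₂ hS hs ht h₁ hd₄ _).mono ?_
      split_ifs with h h'
      · linarith
      · linarith
      · have : (6 : ℝ) ≤ t.length := by exact_mod_cast (show 6 ≤ t.length by omega)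
        linarith
    refine addsAtMost_aop_succ hξ₁ hξ₂ hS hs ?_ ?_ ?_
    · intro h
      have h₂ : t.length ≤ 2 := by omega
      refine (addsAtMost_baseCircuit_of_length_le_five hS ht h₁ (by omega)).mono ?_
      linarith [fewAlternatingBound_le hS ht (show t.length ≤ 5 by omega)]
    · exact fun s' _ _ hs' hle => ih hs' ht h₁ hD ((dMin_mono hξ _ hle).trans hd)
    · intro e j he _ hsimple hj₁ _ hjm hd₁ hd₂
      have hlen : (t.take (2 * j + 1)).length = 2 * j + 1 := by simp; omega
      have hsym : IsSymmetricInput S op.dual (oddEntries (t.take (2 * j + 1))) :=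
        .of_infix hS (ht.take _).odd
      have hodd := length_oddEntries_take hjm.le
      have hj₀ := hj₁.trans (mu_anti (by linarith) e (Nat.zero_le s.length))
      have hdrop : ((t.drop (2 * j + 1)).length : ℝ) = t.length - ((2 * j + 1 : ℕ) : ℝ) := by
        rw [List.length_drop, Nat.cast_sub hjm.le]
      -- For `e = 4` the factor `2.67 + φ(4) = 1` is too small for the parts, so the refined bounds
      -- are added up instead. Here `m ≥ 9`, and `m / 3 ≥ 3` gates are available beyond `b(s) + m`.
      rcases eq_or_lt_of_le (show 4 ≤ e by omega) with rfl | he₅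
      · refine ⟨_, _, addsAtMost_aop_small hξ₁ hξ₂ hS hs (ht.take _) (by omega)
          (by rwa [hlen]) fuel, addsAtMost_aop_small hξ₁ hξ₂ hS hsym (ht.drop j) (by simp; omega)
          (by simpa [hodd] using hd₂) fuel, ?_⟩
        rw [mu_four] at hsimple hj₀
        push_cast at hsimple hj₀
        have hm₉ : 8 < t.length := by
          have : (8 : ℝ) < t.length := by linarith
          exact_mod_cast this
        have hm₉' : (9 : ℝ) ≤ t.length := by exact_mod_cast hm₉
        have hj : j < 4 := by
          have : (j : ℝ) < 4 := by linarith
          exact_mod_cast this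
        have hcount : ∀ c : ℕ, (j + 2) ^ 2 < 2 ^ (c + 3) →
            (boundaryCount S op.dual (oddEntries (t.take (2 * j + 1))) : ℝ) ≤ c := fun c hc => by
          exact_mod_cast boundaryCount_le hS (ht.take _).odd (by rwa [hodd])
        rw [hdrop, hlen, hodd, List.length_drop]
        interval_cases j
        · have := hcount 0 (by norm_num)
          split_ifs <;> first | omega | (push_cast at this ⊢; linarith)
        · have := hcount 1 (by norm_num)
          split_ifs <;> first | omega | (push_cast at this ⊢; linarith)
        · have := hcount 2 (by norm_num)
          split_ifs <;> first | omega | (push_cast at this ⊢; linarith)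
        · have := hcount 2 (by norm_num)
          -- For `j = 3` the prefix of length 7 may have a surplus gate. If `m < 12`, the rest has
          -- at most 4 inputs and saves one; otherwise `m / 3 ≥ 4` suffices.
          by_cases h₁₂ : t.length < 12
          · split_ifs <;> first | omega | (push_cast at this ⊢; linarith)
          · have : (12 : ℝ) ≤ t.length := by exact_mod_cast not_lt.1 h₁₂
            split_ifs <;> first | omega | (push_cast at *; linarith)
      · have hφe : phi ξ e + psi ξ (e + 1) ≤ phi ξ D := by
          rw [← phi_succ ξ he₅.le]
          exact phi_mono (by linarith) (by omega)
        have key : ∀ m : ℕ, 1 ≤ m → (1 : ℝ) ≤ m ∧ 4 / 3 * (m : ℝ) ≤ (2.67 + phi ξ e) * m := by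
          intro m hm
          have h := phi_mono (ξ := ξ) (by linarith) (show 5 ≤ e by omega)
          rw [phi_succ ξ le_rfl, phi_of_le_four ξ le_rfl] at h
          have hψ := one_third_le_psi_five hξ₁ hξ₂
          exact ⟨by exact_mod_cast hm, mul_le_mul_of_nonneg_right (by linarith) (Nat.cast_nonneg _)⟩
        refine ⟨_, _, ih hs (ht.take _) (by omega) (D := e) he₅ (by rwa [hlen]),
          ih hsym (ht.drop j) (by simp; omega) (D := e) he₅ (by simpa [hodd] using hd₂), ?_⟩
        have hb := one_add_le_mul_psi (m := t.length) (by linarith) (by omega) hsimple hj₀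
          (by simpa [hodd] using two_pow_boundaryCount_le hS (ht.take (2 * j + 1)).odd)
        rw [hdrop, hlen]
        have := mul_le_mul_of_nonneg_right hφe (Nat.cast_nonneg (α := ℝ) t.length)
        linarith

/-! ### The circuit -/

theorem evenEntries_and_oddEntries_sublist (t : List ℕ) :
    (evenEntries t).Sublist t ∧ (oddEntries t).Sublist t := by
  induction t with
  | nil => simp
  | cons x t ih => simpa using ⟨ih.2, ih.1.cons x⟩

/-- The bound for the recursive construction if the alternating inputs start the leftist circuit for
the dual operation. -/
theorem addsAtMost_aop (hξ₁ : 1.9 ≤ ξ) (hξ₂ : ξ < 2) (hS : IsLeftistPair S)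
    (hleaves : leaves (S op) = s ++ evenEntries t) (hdual : leaves (S op.dual) = oddEntries t)
    (h₁ : 1 ≤ t.length) (fuel : ℕ) :
    AddsAtMost (aop ξ S fuel op s t)
      ((2.67 + phi ξ (dMin ξ s.length t.length)) * t.length + rho s.length) := by
  have hinf : s <:+: leaves (S op) := hleaves ▸ (List.prefix_append _ _).isInfix
  have hs : IsSymmetricInput S op s := .of_infix hS hinf
  have ht : IsAlternatingInput S op t :=
    ⟨hleaves ▸ (List.suffix_append _ _).isInfix, hdual ▸ List.infix_rfl⟩
  have hρ := le_rho (two_pow_boundaryCount_le hS hinf)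
  rcases le_or_gt (dMin ξ s.length t.length) 4 with hd₄ | hd₅
  · have hm : AddsAtMost (aop ξ S fuel op s t) (boundaryCount S op s + t.length) := by
      by_cases h : t.length ≤ 5 ∨ 2 ≤ s.length
      · refine (addsAtMost_aop_small hξ₁ hξ₂ hS hs ht h₁ hd₄ fuel).mono ?_
        rw [if_pos h]
        split_ifs <;> linarith
      · push Not at h
        refine (addsAtMost_aop_of_dMin_le_four hξ₁ hξ₂ hS hs ht h.1 hd₄ fuel).mono ?_
        have hlen := length_oddEntries_take (j := 2) (t := t) (by omega)
        have hpre := two_pow_length_boundaryTrees_le_of_prefix (hS.forest op.dual)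
          (hS.nodup op.dual) (I := oddEntries (t.take (2 * 2 + 1)))
          (hdual ▸ (evenEntries_and_oddEntries_take t _).2)
        rw [hlen] at hpre
        -- The prefix bound gives `2 ^ b ≤ 3`, whereas a general interval of two leaves may have two
        -- boundary trees.
        have hb : boundaryCount S op.dual (oddEntries (t.take 5)) ≤ 1 := by
          by_contra! H
          have := (Nat.pow_le_pow_right two_pos H).trans hpre
          norm_num at this
        have hb' : ((boundaryCount S op.dual (oddEntries (t.take 5)) : ℕ) : ℝ) ≤ 1 := by
          exact_mod_cast hb
        rw [if_pos (by omega)]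
        linarith
    refine hm.mono ?_
    rw [phi_of_le_four ξ hd₄]
    linarith
  · exact (addsAtMost_aop_of_five_le hξ₁ hξ₂ hS hs ht h₁ hd₅ le_rfl fuel).mono (by linarith)

/-- The bound on the number of additional gates of the constructed circuit. -/
theorem numAdditionalGates_aopCircuit_le (hξ₁ : 1.9 ≤ ξ) (hξ₂ : ξ < 2) (n m : ℕ) (hm : 1 ≤ m) :
    ((aopCircuit ξ n m).numAdditionalGates : ℝ) ≤
      (2.67 + phi ξ (dMin ξ n m)) * m + rho n := by
  set s := List.range n with hs
  set t := (List.range m).map (n + ·) with ht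
  have hsl : s.length = n := by simp [hs]
  have htl : t.length = m := by simp [ht]
  have htn : t.Nodup := List.nodup_range.map (add_right_injective n)
  obtain ⟨heven, hodd⟩ := evenEntries_and_oddEntries_sublist t
  let p₀ := (leftist .and (s ++ evenEntries t)).run ⟨n + m, []⟩
  let p₁ := (leftist .or (oddEntries t)).run p₀.2
  obtain ⟨⟨a₁, a₂⟩, a₃⟩ := leftist_spec .and (s ++ evenEntries t) ⟨n + m, []⟩
  obtain ⟨⟨b₁, b₂⟩, b₃⟩ := leftist_spec .or (oddEntries t) p₀.2
  let S : Op → List Tree := fun op => match op with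
    | .and => p₀.1
    | .or => p₁.1
  have hnd : (s ++ evenEntries t).Nodup := by
    refine List.nodup_append'.2 ⟨List.nodup_range, htn.sublist heven, fun x hx hx' => ?_⟩
    have h₁ : x < n := List.mem_range.1 hx
    obtain ⟨y, -, rfl⟩ := List.mem_map.1 (heven.subset hx')
    omega
  have hS : IsLeftistPair S :=
    ⟨fun op => match op with
      | .and => a₁
      | .or => b₁, fun op => match op with
      | .and => (congrArg List.Nodup a₂).mpr hnd
      | .or => (congrArg List.Nodup b₂).mpr (htn.sublist hodd)⟩
  have h : ((aopCircuit ξ n m).numAdditionalGates : ℝ) ≤ p₁.2.numAdditionalGates +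
      ((2.67 + phi ξ (dMin ξ s.length t.length)) * t.length + rho s.length) :=
    addsAtMost_aop (op := .and) hξ₁ hξ₂ hS a₂ b₂ (by omega) (s.length + t.length) p₁.2
  have h₀ : p₁.2.numAdditionalGates = 0 := b₃.trans a₃
  rw [h₀, Nat.cast_zero, zero_add, hsl, htl] at h
  exact h

end AndOrPath

theorem mainTheorem10 (ξ : ℝ) (hξ₁ : 1.9 ≤ ξ) (hξ₂ : ξ < 2) (n m : ℕ) (hm : 1 ≤ m) :
    ((AndOrPath.aopCircuit ξ n m).numAdditionalGates : ℝ) ≤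
      (2.67 + AndOrPath.phi ξ (AndOrPath.dMin ξ n m)) * m + AndOrPath.rho n := by
  exact AndOrPath.numAdditionalGates_aopCircuit_le hξ₁ hξ₂ n m hm
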